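/- **Well-scaled continuous-space limit of the space-time Mittag-Leffler process.** Let $\alpha,\beta\in(0,1]$, $\lambda_0,\xi>0$. For $\lambda>0$ the state probabilities $p_n(t)$ ($n\in\mathbb N_0$, $t\ge 0$) of the space-time Mittag-Leffler process are the solution of the Cauchy problem $$\frac{d^\beta}{dt^\beta}p_n(t)=-\xi(\lambda+1)\sum_{k=0}^n p_k(t)\,g_{n-k},\qquad p_n(0)=\delta_{n,0},\qquad \sum_{j\ge 0} g_j u^j=\frac{(1-u)^\alpha}{\lambda+(1-u)^\alpha},$$ with the Caputo derivative of order $\beta$ ($p_n$ continuous on $[0,\infty)$, $C^1$ on $(0,\infty)$, with $p_n'$ integrable near $0$). Let $\mathcal E^{(m)}_\alpha(\lambda,n)$ ($m,n\in\mathbb N_0$) be the coefficients in $\sum_n \mathcal E^{(m)}_\alpha(\lambda,n)u^n=[1+\lambda(1-u)^{-\alpha}]^{-m}$. Let $E^{\gamma}_{a,b}(z)=\sum_{s\ge0}\frac{(\gamma)_s}{s!}\frac{z^s}{\Gamma(as+b)}$ be the Prabhakar function, $\Theta$ the Heaviside function with $\Theta(0)=1$, $D_x$ the distributional derivative on $\mathbb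 R$, and define the distribution $$e^m_{\alpha,0}(-\lambda_0,x)=\delta(x)+\kappa_m(x),\qquad \kappa_m(x)=\Theta(x)\sum_{s\ge1}\frac{(m)_s(-\lambda_0)^s x^{\alpha s-1}}{s!\,\Gamma(\alpha s)} .$$ A sequence $(q_n)_{n\ge 0}$ on the lattice $h\mathbb N_0$ is identified with the function $x\mapsto \frac1h q_{\lfloor x/h\rfloor}$ on $[0,\infty)$, zero on $(-\infty,0)$ (value $\frac1h q_{x/h}$ at $x\in h\mathbb N_0$). "Limit in the sense of distributions" means convergence against every $\varphi\in C_c^\infty(\mathbb R)$. (a) For every $m\in\mathbb N_0$, as $h\to0^+$, $\frac1h\mathcal E^{(m)}_\alpha(\lambda_0h^\alpha,\lfloor x/h\rfloor)\to e^m_{\alpha,0}(-\lambda_0,x)$ in the sense of distributions, and $\frac1h\mathcal E^{(m)}_\alpha(\lambda_0h^\alpha,\lfloor x/h\rfloor)\to \kappa_m(x)$ for each $x>0$. Moreover $e^m_{\alpha,0}(-\lambda_0,x)=D_x[\Theta(x)E^m_{\alpha,1}(-\lambda_0x^\alpha)]$, and it is the Prabhakar kernel: for $s\in\mathbb C$ with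 $\Re s>0$, $(\Re s)^\alpha>\lambda_0$, the Laplace integral of $\kappa_m$ converges absolutely and $1+\int_0^\infty e^{-sx}\kappa_m(x)\,dx=(1+\lambda_0s^{-\alpha})^{-m}$. (b) For $h>0$ let $p^{(h)}_n(t)$ be the state probabilities with $\lambda=\lambda_0h^\alpha$. For every $t\ge0$ the limit of $\frac1hp^{(h)}_{\lfloor x/h\rfloor}(t)$ as $h\to0^+$ exists in the sense of distributions, and this state density $\mathcal P(x,t)$ satisfies $$\mathcal P(x,t)=\sum_{m=0}^\infty\frac{(-\xi t^\beta)^m}{\Gamma(\beta m+1)}\,e^m_{\alpha,0}(-\lambda_0,x)=D_x\Big[\Theta(x)\sum_{m=0}^\infty\frac{(-\xi t^\beta)^m}{\Gamma(\beta m+1)}E^m_{\alpha,1}(-\lambda_0x^\alpha)\Big],$$ where the first series converges in the sense of distributions and the second at every $x\ge0$. For each $x>0$ also $\frac1hp^{(h)}_{\lfloor x/h\rfloor}(t)\to\sum_{m}\frac{(-\xi t^\beta)^m}{\Gamma(\beta m+1)}\kappa_m(x)$, a convergent series. -/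

import Mathlib

open MeasureTheory Filter Topology TopologicalSpace Set
open scoped Distributions LineDeriv

noncomputable section

namespace SpaceTimeML

/-- The Prabhakar function `E^γ_{a,b}(z) = ∑ₛ (γ)ₛ / s! * z ^ s / Γ(a s + b)`. -/
def prabhakar (a b γ z : ℝ) : ℝ :=
  ∑' s : ℕ, (ascPochhammer ℝ s).eval γ / (s.factorial : ℝ) * (z ^ s / Real.Gamma (a * s + b))

/-- The `n`-th coefficient of the power series (generating function) of `f` at `0`. -/
def gfCoeff (f : ℝ → ℝ) (n : ℕ) : ℝ := iteratedDeriv n f 0 / (n.factorial : ℝ)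

/-- Generating function `g(1 - u) = (1 - u) ^ α / (lam + (1 - u) ^ α)` of the Mittag-Leffler
Laplacian matrix. -/
def gML (α lam u : ℝ) : ℝ := (1 - u) ^ α / (lam + (1 - u) ^ α)

/-- The discrete coefficients `𝓔_α^(m)(lam, n)`, with generating function
`∑ₙ 𝓔_α^(m)(lam, n) u ^ n = (1 + lam (1 - u) ^ (-α)) ^ (-m)`. -/
def discretePrabhakar (α : ℝ) (m : ℕ) (lam : ℝ) (n : ℕ) : ℝ :=
  gfCoeff (fun u => ((1 + lam * (1 - u) ^ (-α)) ^ m)⁻¹) n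

/-- The Caputo derivative of order `β ∈ (0, 1]` at `t > 0`. -/
def caputoDeriv (β : ℝ) (f : ℝ → ℝ) (t : ℝ) : ℝ :=
  if β = 1 then deriv f t
  else (Real.Gamma (1 - β))⁻¹ * ∫ τ in (0 : ℝ)..t, (t - τ) ^ (-β) * deriv f τ

/-- `p n t`, `n ∈ ℕ`, `t ≥ 0`, are the state probabilities of the space-time Mittag-Leffler process
with parameters `α, β, lam, ξ`: they solve the Cauchy problem
`d^β/dt^β p_n(t) = - ξ (lam + 1) ∑_{k ≤ n} p_k(t) g_{n-k}`, `p_n(0) = δ_{n,0}`, where `g_j` are the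
entries of the Laplacian matrix `L^α / (lam + L^α)`. The first three fields fix the usual class of
solutions in which the Caputo derivative is defined. -/
structure IsStateProb (α β lam ξ : ℝ) (p : ℕ → ℝ → ℝ) : Prop where
  continuousOn : ∀ n, ContinuousOn (p n) (Ici 0)
  contDiffOn : ∀ n, ContDiffOn ℝ 1 (p n) (Ioi 0)
  integrable_deriv : ∀ n, ∀ T : ℝ, IntegrableOn (deriv (p n)) (Ioc 0 T)
  init : ∀ n, p n 0 = if n = 0 then 1 else 0
  evol : ∀ n, ∀ t : ℝ, 0 < t →
    caputoDeriv β (p n) t =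
      -ξ * (lam + 1) * ∑ k ∈ Finset.range (n + 1), p k t * gfCoeff (gML α lam) (n - k)

/-- The regular distribution on `ℝ` given by a locally integrable function. -/
def regularDist (f : ℝ → ℝ) : 𝓓'((⊤ : Opens ℝ), ℝ) :=
  ContinuousLinearMap.toUniformConvergenceCLM _ _ _
    (TestFunction.integralAgainstBilinCLM (ContinuousLinearMap.mul ℝ ℝ) volume f)

/-- The density `x ↦ q_{⌊x / h⌋} / h` on `[0, ∞)` (and zero on `(-∞, 0)`) of a sequence `q` placed
on the lattice `h ℕ`, that is `∑ₙ q_n δ_h(x - h n)` with `δ_h = h⁻¹` on `[0, h)` and `0` elsewhere.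
For `x = h n` its value is `q_n / h`. -/
def latticeDensity (h : ℝ) (q : ℕ → ℝ) (x : ℝ) : ℝ :=
  if 0 ≤ x then (1 / h) * q ⌊x / h⌋₊ else 0

/-- The regular part `∑_{s ≥ 1} (γ)ₛ ζ ^ s x ^ (α s - 1) / (s! Γ(α s))`, `x > 0`, of the Prabhakar
kernel `e^γ_{α,0}(ζ, x)`. -/
def prabhakarDensity (α γ ζ x : ℝ) : ℝ :=
  if 0 < x then
    ∑' s : ℕ, (ascPochhammer ℝ (s + 1)).eval γ / ((s + 1).factorial : ℝ) *
      (ζ ^ (s + 1) * x ^ (α * ((s : ℝ) + 1) - 1) / Real.Gamma (α * ((s : ℝ) + 1)))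
  else 0

/-- The Prabhakar kernel `e^γ_{α,0}(ζ, ·)` as a distribution:
`δ(x) + ∑_{s ≥ 1} (γ)ₛ ζ ^ s x ^ (α s - 1) / (s! Γ(α s))`. -/
def prabhakarKernel (α γ ζ : ℝ) : 𝓓'((⊤ : Opens ℝ), ℝ) :=
  Distribution.delta 0 + regularDist (prabhakarDensity α γ ζ)

/-- The Heaviside function, with `Θ(0) = 1`. -/
def heaviside (x : ℝ) : ℝ := if 0 ≤ x then 1 else 0

/-- The coefficient `(-ξ t ^ β) ^ m / Γ(β m + 1)`. -/
def mlCoeff (β ξ t : ℝ) (m : ℕ) : ℝ := (-ξ * t ^ β) ^ m / Real.Gamma (β * m + 1)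

end SpaceTimeML

end

namespace SpaceTimeML

/-! Everything is expanded in powers of `lam (1 - u) ^ (-α)`. By the binomial series
(`hasSum_generating`), the discrete coefficients are `∑ₛ (m)ₛ / s! (-lam) ^ s (αs)ₙ / n!`. With `lam
= lam₀ h ^ α` and `n = ⌊x / h⌋`, Euler's limit formula for Gamma turns `h⁻¹ h ^ (αs) (αs)ₙ / n!`
into `x ^ (αs - 1) / Γ(αs)` for `s ≥ 1` (`tendsto_lattice_term`). The term `s = 0` lives only at `n
= 0`; together with the vanishing remainder of the first cell it produces the delta.

The limit may be taken under the sum and under the integral because the lattice terms, uniformly in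
small `h` and for `x ≥ h`, are at most an integrable multiple of `x ^ (α - 1)` times `2 ^ (-s)`,
even after multiplication by `2 ^ s` (`lattice_term_le`). Hence any weights `c h s` that are `O(2 ^
s)` uniformly in `h` and converge as `h → 0` are admissible. `IsLatticeApprox` records this
situation, and `tendsto_pointwise` and `tendsto_distribution` are its two limit theorems. Part (a)
is the case of constant weights `(m)ₛ / s!`.

For part (b), the Caputo problem becomes a Volterra equation, and Picard iteration shows that every
solution is the Mittag-Leffler series `∑ₘ (-ξ (lam + 1) t ^ β) ^ m / Γ(βm + 1) 𝓔^(m)`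
(`hasSum_seriesTerm`), because the `𝓔^(m)` are the convolution powers of `g`. Exchanging the sums
over `m` and `s` (`hasSum_stateProb_weights`) brings `p_n` into the same form, with weights `∑ₘ aₘ
(m)ₛ / s!` that converge as `h → 0`.

The derivative formulas follow by integrating by parts term by term
(`lineDeriv_regularDist_kernelPrimitive`). The Laplace transform is a termwise Gamma integral summed
by the binomial series (`laplace_prabhakarDensity`). -/

/-! ### Binomial coefficients `(a)ₙ / n!`: bounds and asymptotics. -/

/-- The coefficient `(a)ₙ / n!` of `u ^ n` in `(1 - u) ^ (-a)`. -/
noncomputable def risingCoeff (a : ℝ) (n : ℕ) : ℝ :=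
  (ascPochhammer ℝ n).eval a / (n.factorial : ℝ)

lemma risingCoeff_zero_right (a : ℝ) : risingCoeff a 0 = 1 := by simp [risingCoeff]

lemma risingCoeff_zero_left {n : ℕ} (hn : n ≠ 0) : risingCoeff 0 n = 0 := by
  simp [risingCoeff, hn]

lemma risingCoeff_nonneg {a : ℝ} (ha : 0 ≤ a) (n : ℕ) : 0 ≤ risingCoeff a n := by
  rcases ha.eq_or_lt with rfl | ha
  · rcases eq_or_ne n 0 with rfl | hn
    · simp [risingCoeff_zero_right]
    · simp [risingCoeff_zero_left hn]
  · exact div_nonneg (ascPochhammer_pos n a ha).le (by positivity)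

lemma succ_mul_risingCoeff_succ (a : ℝ) (n : ℕ) :
    ((n : ℝ) + 1) * risingCoeff a (n + 1) = (a + n) * risingCoeff a n := by
  have : (n.factorial : ℝ) ≠ 0 := by positivity
  rw [risingCoeff, risingCoeff, ascPochhammer_succ_eval, Nat.factorial_succ]
  push_cast
  field_simp

lemma mul_risingCoeff_eq_sum (a : ℝ) (n : ℕ) :
    (n : ℝ) * risingCoeff a n = a * ∑ k ∈ Finset.range n, risingCoeff a k := by
  induction n with
  | zero => simp
  | succ n ih =>
    rw [Finset.sum_range_succ, mul_add, ← ih]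
    push_cast
    rw [succ_mul_risingCoeff_succ]
    ring

lemma choose_eq_ascPochhammer_div {R : Type*} [Field R] [CharZero R] (a : R) (n : ℕ) :
    Ring.choose (a + n - 1) n = (ascPochhammer R n).eval a / (n.factorial : R) := by
  have h : (n.factorial : R) ≠ 0 := Nat.cast_ne_zero.2 n.factorial_ne_zero
  have := Ring.factorial_nsmul_multichoose_eq_ascPochhammer a n
  rw [Polynomial.ascPochhammer_smeval_eq_eval, nsmul_eq_mul] at this
  rw [eq_div_iff h, ← this, Ring.choose, show a + n - 1 - n + 1 = a by ring, mul_comm]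

lemma hasSum_risingCoeff (a : ℝ) {u : ℝ} (hu : |u| < 1) :
    HasSum (fun n => risingCoeff a n * u ^ n) ((1 - u) ^ (-a)) := by
  have hu' : u ∈ Metric.eball (0 : ℝ) 1 := by
    simpa [← ENNReal.ofReal_one, Metric.eball_ofReal] using hu
  have := (Real.one_div_one_sub_rpow_hasFPowerSeriesOnBall_zero a).hasSum hu'
  have h0 : 0 ≤ 1 - u := by linarith [(abs_lt.1 hu).2]
  simpa [choose_eq_ascPochhammer_div, risingCoeff, Real.rpow_neg h0, mul_comm] using this

lemma hasSum_risingCoeff_complex (m : ℕ) {z : ℂ} (hz : ‖z‖ < 1) :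
    HasSum (fun n => (risingCoeff m n : ℂ) * (-z) ^ n) (((1 + z) ^ m)⁻¹) := by
  have hz' : -z ∈ Metric.eball (0 : ℂ) 1 := by
    simpa [← ENNReal.ofReal_one, Metric.eball_ofReal] using hz
  have := (Complex.one_div_one_sub_cpow_hasFPowerSeriesOnBall_zero m).hasSum hz'
  have hc (n : ℕ) : (risingCoeff m n : ℂ) = Ring.choose ((m : ℂ) + n - 1) n := by
    rw [risingCoeff, ← choose_eq_ascPochhammer_div, Complex.ofReal_choose]
    push_cast
    rfl
  simp_rw [hc]
  simpa [mul_comm] using this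

/-- A single term of a nonnegative series is at most its sum at `u = r`; the radius `r` stays free.
-/
lemma risingCoeff_le {a r : ℝ} (ha : 0 ≤ a) (hr : 0 < r) (hr1 : r < 1) (n : ℕ) :
    risingCoeff a n ≤ (r ^ n)⁻¹ * (1 - r) ^ (-a) := by
  have h := hasSum_risingCoeff a (u := r) (by rwa [abs_of_pos hr])
  have := le_hasSum h n fun k _ => mul_nonneg (risingCoeff_nonneg ha k) (by positivity)
  rw [inv_mul_eq_div, le_div_iff₀ (by positivity)]
  exact this

/-- The factor `n` is absorbed by `n (a)ₙ / n! = a ∑_{k < n} (a)ₖ / k!`, and the partial sum is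
bounded as before. On the lattice this gain of `1 / n` compensates the factor `1 / h` of the
density. -/
lemma mul_risingCoeff_le {a r : ℝ} (ha : 0 ≤ a) (hr : 0 < r) (hr1 : r < 1) (n : ℕ) :
    n * risingCoeff a n ≤ a * ((r ^ n)⁻¹ * (1 - r) ^ (-a)) := by
  rw [mul_risingCoeff_eq_sum]
  refine mul_le_mul_of_nonneg_left ?_ ha
  have h := hasSum_risingCoeff a (u := r) (by rwa [abs_of_pos hr])
  have := sum_le_hasSum (Finset.range n) (fun k _ =>
    mul_nonneg (risingCoeff_nonneg ha k) (by positivity)) h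
  rw [inv_mul_eq_div, le_div_iff₀ (by positivity), Finset.sum_mul]
  refine (Finset.sum_le_sum fun k hk => ?_).trans this
  exact mul_le_mul_of_nonneg_left (pow_le_pow_of_le_one hr.le hr1.le (Finset.mem_range.1 hk).le)
    (risingCoeff_nonneg ha k)

lemma risingCoeff_natCast_le (m s : ℕ) : risingCoeff m s ≤ 2 ^ m * 2 ^ s := by
  refine (risingCoeff_le (a := m) (r := 1 / 2) (by positivity) (by norm_num) (by norm_num) s).trans
    (le_of_eq ?_)
  rw [show (1 : ℝ) - 1 / 2 = 2⁻¹ by norm_num, Real.inv_rpow (by norm_num), Real.rpow_neg (by norm_num),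
    inv_inv, Real.rpow_natCast, one_div, inv_pow, inv_inv, mul_comm]

/-- Euler's limit for Gamma; the product in `GammaSeq` has the additional factor `a + n`, which
accounts for `n / (n + a) → 1`. -/
lemma tendsto_risingCoeff {a : ℝ} (ha : 0 < a) :
    Tendsto (fun n : ℕ => (n : ℝ) ^ (1 - a) * risingCoeff a n) atTop (𝓝 (Real.Gamma a)⁻¹) := by
  have h1 : Tendsto (fun n : ℕ => (n : ℝ) / (n + a)) atTop (𝓝 1) := tendsto_natCast_div_add_atTop a
  have h2 := h1.mul ((Real.GammaSeq_tendsto_Gamma a).inv₀ (Real.Gamma_pos_of_pos ha).ne')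
  rw [one_mul] at h2
  refine h2.congr' ?_
  filter_upwards [eventually_gt_atTop 0] with n hn
  have hn' : (0 : ℝ) < n := by exact_mod_cast hn
  have hp : ∏ j ∈ Finset.range (n + 1), (a + j) = (ascPochhammer ℝ n).eval a * (a + n) := by
    rw [← ascPochhammer_succ_eval]
    induction n + 1 with
    | zero => simp
    | succ k ih => rw [Finset.prod_range_succ, ih, ascPochhammer_succ_eval]
  have hpos := ascPochhammer_pos n a ha
  rw [Real.GammaSeq, hp, risingCoeff, Real.rpow_sub hn', Real.rpow_one]
  have := Real.rpow_pos_of_pos hn' a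
  field_simp
  ring

/-! ### Growth of the Gamma function. -/

lemma exp_neg_two_mul_le {y : ℝ} (h0 : 0 ≤ y) (h1 : y ≤ 1 / 2) : Real.exp (-(2 * y)) ≤ 1 - y := by
  have h := Real.add_one_le_exp (2 * y)
  rw [Real.exp_neg, inv_le_comm₀ (Real.exp_pos _) (by linarith)]
  refine le_trans ?_ h
  rw [inv_le_iff_one_le_mul₀ (by linarith)]
  nlinarith

/-- Restrict Euler's integral to `(K, ∞)`, where `x ^ a ≥ K ^ a`. As `K` is arbitrary, `1 / Γ(a +
1)` decays faster than any geometric rate in `a`. -/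
lemma rpow_mul_exp_neg_le_Gamma {K a : ℝ} (hK : 0 < K) (ha : 0 ≤ a) :
    K ^ a * Real.exp (-K) ≤ Real.Gamma (a + 1) := by
  rw [Real.Gamma_eq_integral (by linarith)]
  have hint := Real.GammaIntegral_convergent (s := a + 1) (by linarith)
  rw [← integral_exp_neg_Ioi K, ← integral_const_mul]
  refine (setIntegral_mono_on (((integrableOn_exp_neg_Ioi K)).const_mul _)
    (hint.mono_set (Ioi_subset_Ioi hK.le)) measurableSet_Ioi fun x hx => ?_).trans
    (setIntegral_mono_set hint ?_ (Ioi_subset_Ioi hK.le).eventuallyLE)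
  · rw [mul_comm, add_sub_cancel_right]
    exact mul_le_mul_of_nonneg_left (Real.rpow_le_rpow hK.le (le_of_lt hx) ha) (Real.exp_pos _).le
  · filter_upwards [ae_restrict_mem measurableSet_Ioi] with x hx
    exact mul_nonneg (Real.exp_pos _).le (Real.rpow_nonneg (le_of_lt hx) _)

lemma inv_Gamma_add_one_le {K a : ℝ} (hK : 0 < K) (ha : 0 ≤ a) :
    (Real.Gamma (a + 1))⁻¹ ≤ Real.exp K * K ^ (-a) := by
  have h := rpow_mul_exp_neg_le_Gamma hK ha
  have := inv_anti₀ (by positivity) h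
  rwa [mul_inv, Real.exp_neg, inv_inv, mul_comm, ← Real.rpow_neg hK.le] at this

lemma summable_pow_div_Gamma {β : ℝ} (hβ : 0 < β) {z : ℝ} (hz : 0 ≤ z) :
    Summable fun m : ℕ => z ^ m / Real.Gamma (β * m + 1) := by
  -- Chosen so that `K ^ (-β) = 1 / (2z + 1)`, which makes the ratio `z / (2z + 1) < 1`.
  set K : ℝ := (2 * z + 1) ^ (β⁻¹) with hK
  have hKp : 0 < K := by positivity
  have hKβ : K ^ (-β) = (2 * z + 1)⁻¹ := by
    rw [hK, ← Real.rpow_mul (by positivity), mul_neg, inv_mul_cancel₀ hβ.ne', Real.rpow_neg_one]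
  have hq : z * (2 * z + 1)⁻¹ < 1 := by
    rw [← div_eq_mul_inv, div_lt_one (by positivity)]; linarith
  refine Summable.of_nonneg_of_le (fun m => ?_) (fun m => ?_)
    ((summable_geometric_of_lt_one (by positivity) hq).mul_left (Real.exp K))
  · exact div_nonneg (by positivity) (Real.Gamma_pos_of_pos (by positivity)).le
  · have h := inv_Gamma_add_one_le hKp (a := β * m) (by positivity)
    rw [div_eq_mul_inv]
    refine (mul_le_mul_of_nonneg_left h (by positivity)).trans (le_of_eq ?_)
    rw [← neg_mul, Real.rpow_mul hKp.le, hKβ, Real.rpow_natCast, mul_pow]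
    ring

/-! ### Majorants, geometric in `s`, for kernel terms and their lattice versions. -/

section

/-- The summand `ζ ^ (s + 1) x ^ (α (s + 1) - 1) / Γ(α (s + 1))` of a kernel density. -/
noncomputable def densityTerm (α ζ x : ℝ) (s : ℕ) : ℝ :=
  ζ ^ (s + 1) * x ^ (α * ((s : ℝ) + 1) - 1) / Real.Gamma (α * ((s : ℝ) + 1))

/-- The summand `(ζ x ^ α) ^ s / Γ(α s + 1)` of the primitive of a kernel. -/
noncomputable def primitiveTerm (α ζ x : ℝ) (s : ℕ) : ℝ :=
  (ζ * x ^ α) ^ s / Real.Gamma (α * s + 1)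

/-- An integrable majorant near `0` for kernel densities and their lattice approximations. -/
noncomputable def kernelMajorant (α lam K x : ℝ) : ℝ :=
  8 * lam * 4 ^ α * Real.exp (2 * K * x + 1 / 2) * x ^ (α - 1)

/-- The requirements on the exponential rate `K` in `kernelMajorant`. -/
structure IsRate (α lam K : ℝ) : Prop where
  pos : 0 < K
  le : 4 * lam * K ^ (-α) ≤ 1 / 2

lemma exists_isRate {α lam : ℝ} (hα : 0 < α) (hlam : 0 < lam) : ∃ K, IsRate α lam K := by
  refine ⟨(8 * lam) ^ (α⁻¹), by positivity, ?_⟩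
  rw [← Real.rpow_mul (by positivity), mul_neg, inv_mul_cancel₀ hα.ne', Real.rpow_neg_one]
  field_simp
  norm_num

lemma natCast_succ_le_two_pow (s : ℕ) : (s : ℝ) + 1 ≤ 2 ^ (s + 1) := by
  exact_mod_cast (Nat.lt_two_pow_self (n := s + 1)).le

variable {α lam K x : ℝ}

lemma kernelMajorant_nonneg (hlam : 0 < lam) (hx : 0 < x) : 0 ≤ kernelMajorant α lam K x := by
  unfold kernelMajorant; positivity

/-- The rate `L = K + 1 / (4x)` serves three purposes. From `L ≥ K`, all but one of the ratios are
at most `1 / 2`. From `L ≥ 1 / (4x)`, the remaining factor `L ^ (-α)` is at most `4 ^ α x ^ α`,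
which improves `1 / x` to the integrable `x ^ (α - 1)`. And `exp (2 L x)` costs only the constant
`exp (1 / 2)` beyond `exp (2 K x)`. -/
lemma geometric_le_kernelMajorant (hα : 0 < α) (hlam : 0 < lam) (hK : IsRate α lam K) (hx : 0 < x)
    (s : ℕ) :
    2 / x * Real.exp (2 * ((K + 1 / (4 * x)) * x)) * (4 * lam * (K + 1 / (4 * x)) ^ (-α)) ^ (s + 1) ≤
      kernelMajorant α lam K x * (1 / 2) ^ s := by
  have hK0 := hK.pos
  have h1 : (K + 1 / (4 * x)) ^ (-α) ≤ K ^ (-α) :=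
    Real.rpow_le_rpow_of_nonpos hK0 (by simp; positivity) (by linarith)
  have h2 : (K + 1 / (4 * x)) ^ (-α) ≤ 4 ^ α * x ^ α := by
    rw [← Real.mul_rpow (by norm_num) hx.le]
    refine (Real.rpow_le_rpow_of_nonpos (x := 1 / (4 * x)) (by positivity) (by linarith)
      (by linarith)).trans (le_of_eq ?_)
    rw [one_div, Real.inv_rpow (by positivity), Real.rpow_neg (by positivity), inv_inv]
  have h3 : (4 * lam * (K + 1 / (4 * x)) ^ (-α)) ^ (s + 1) ≤
      (1 / 2) ^ s * (4 * lam * (4 ^ α * x ^ α)) := by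
    rw [pow_succ]
    refine mul_le_mul (pow_le_pow_left₀ (by positivity) ?_ _) ?_ (by positivity) (by positivity)
    · exact (mul_le_mul_of_nonneg_left h1 (by positivity)).trans hK.le
    · exact mul_le_mul_of_nonneg_left h2 (by positivity)
  refine (mul_le_mul_of_nonneg_left h3 (by positivity)).trans (le_of_eq ?_)
  rw [kernelMajorant, Real.rpow_sub_one hx.ne',
    show 2 * ((K + 1 / (4 * x)) * x) = 2 * K * x + 1 / 2 by field_simp; ring]
  field_simp
  ring

/-- Write `1 / Γ(a) = a / Γ(a + 1)` and apply `inv_Gamma_add_one_le` at `L x`, so that the powers of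
`x` cancel. The weight `2 ^ (s + 1)` leaves room for coefficients `c s = O(2 ^ s)`; a second factor
`2 ^ (s + 1)` absorbs `a`. -/
lemma abs_densityTerm_le (hα : α ∈ Ioc (0 : ℝ) 1) (hlam : 0 < lam) (hK : IsRate α lam K)
    (hx : 0 < x) (s : ℕ) :
    2 ^ (s + 1) * |densityTerm α (-lam) x s| ≤ kernelMajorant α lam K x * (1 / 2) ^ s := by
  have hα0 := hα.1
  have hK0 := hK.pos
  refine le_trans ?_ (geometric_le_kernelMajorant hα0 hlam hK hx s)
  set L := K + 1 / (4 * x)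
  have hL : 0 < L := by positivity
  set a : ℝ := α * ((s : ℝ) + 1) with ha
  have ha0 : 0 < a := by positivity
  have hG := Real.Gamma_pos_of_pos ha0
  have habs : |densityTerm α (-lam) x s| = lam ^ (s + 1) * (x ^ a / x * (a * (Real.Gamma (a + 1))⁻¹)) := by
    rw [densityTerm, ← ha, abs_div, abs_mul, abs_pow, abs_neg, abs_of_pos hlam,
      abs_of_pos hG, abs_of_pos (Real.rpow_pos_of_pos hx _), Real.Gamma_add_one ha0.ne',
      Real.rpow_sub_one hx.ne']
    field_simp
  have h1 : (Real.Gamma (a + 1))⁻¹ ≤ Real.exp (2 * (L * x)) * (L ^ (-a) * x ^ (-a)) := by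
    rw [← Real.mul_rpow hL.le hx.le]
    refine (inv_Gamma_add_one_le (K := L * x) (by positivity) ha0.le).trans ?_
    exact mul_le_mul_of_nonneg_right (Real.exp_le_exp.2 (by nlinarith [mul_pos hL hx]))
      (by positivity)
  have h2 : a ≤ 2 ^ (s + 1) := by
    refine le_trans ?_ (natCast_succ_le_two_pow s)
    rw [ha]; exact mul_le_of_le_one_left (by positivity) hα.2
  have h3 : L ^ (-a) = (L ^ (-α)) ^ (s + 1) := by
    rw [← Real.rpow_natCast, ← Real.rpow_mul hL.le, ha]; push_cast; ring_nf
  rw [habs]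
  calc _ ≤ 2 ^ (s + 1) * (lam ^ (s + 1) * (x ^ a / x * (2 ^ (s + 1) *
        (Real.exp (2 * (L * x)) * (L ^ (-a) * x ^ (-a)))))) := by gcongr
    _ = 1 / x * Real.exp (2 * (L * x)) * (4 * lam * L ^ (-α)) ^ (s + 1) := by
      rw [h3, Real.rpow_neg hx.le, show (4 : ℝ) = 2 * 2 by norm_num]
      have := Real.rpow_pos_of_pos hx a
      simp only [mul_pow]
      field_simp
    _ ≤ _ := by gcongr; norm_num

lemma half_div_le_floor {h x : ℝ} (hh : 0 < h) (hx : h ≤ x) : x / (2 * h) ≤ ⌊x / h⌋₊ := by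
  have h1 : 1 ≤ x / h := (one_le_div hh).2 hx
  have h2 : (1 : ℝ) ≤ ⌊x / h⌋₊ := by exact_mod_cast Nat.le_floor (by simpa using h1)
  have h3 := Nat.lt_floor_add_one (x / h)
  rw [mul_comm, ← div_div]
  linarith

/-- Discrete counterpart of `abs_densityTerm_le`, from `mul_risingCoeff_le` at `r = 1 - L h`: then
`(1 - r) ^ (-a) = (L h) ^ (-a)` cancels the power of `h`, `r ^ (-n) ≤ exp (2 L x)` since `n h ≤ x`,
and `1 / n ≤ 2 h / x` cancels `1 / h`. -/
lemma lattice_term_le (hα : α ∈ Ioc (0 : ℝ) 1) (hlam : 0 < lam) (hK : IsRate α lam K)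
    {h : ℝ} (hh : 0 < h) (hx : h ≤ x) (hKh : 4 * K * h ≤ 1) (s : ℕ) :
    1 / h * (2 ^ (s + 1) * ((lam * h ^ α) ^ (s + 1) *
        risingCoeff (α * ((s : ℝ) + 1)) ⌊x / h⌋₊)) ≤ kernelMajorant α lam K x * (1 / 2) ^ s := by
  have hα0 := hα.1
  have hK0 := hK.pos
  have hx0 : 0 < x := hh.trans_le hx
  refine le_trans ?_ (geometric_le_kernelMajorant hα0 hlam hK hx0 s)
  set L := K + 1 / (4 * x) with hLdef
  have hL : 0 < L := by positivity
  -- Each summand of `L` contributes at most `1 / 4`, by `4 K h ≤ 1` and `h ≤ x`.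
  have hLh : L * h ≤ 1 / 2 := by
    have : 1 / (4 * x) * h ≤ 1 / 4 := by rw [div_mul_eq_mul_div, div_le_iff₀ (by positivity)]; linarith
    rw [hLdef, add_mul]; linarith
  have hLh0 : 0 < L * h := by positivity
  set a : ℝ := α * ((s : ℝ) + 1) with ha
  have ha0 : 0 < a := by positivity
  set n := ⌊x / h⌋₊ with hn
  have hn1 : x / (2 * h) ≤ n := half_div_le_floor hh hx
  have hn0 : (0 : ℝ) < n := lt_of_lt_of_le (by positivity) hn1
  have hn2 : n * h ≤ x := by
    rw [← le_div_iff₀ hh]; exact Nat.floor_le (by positivity)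
  have h1 := mul_risingCoeff_le ha0.le (r := 1 - L * h) (by linarith) (by linarith) n
  have h2 : a ≤ 2 ^ (s + 1) := by
    refine le_trans ?_ (natCast_succ_le_two_pow s)
    rw [ha]; exact mul_le_of_le_one_left (by positivity) hα.2
  have h3 : L ^ (-a) = (L ^ (-α)) ^ (s + 1) := by
    rw [← Real.rpow_natCast, ← Real.rpow_mul hL.le, ha]; push_cast; ring_nf
  have h3' : h ^ (-a) = ((h ^ α) ^ (s + 1))⁻¹ := by
    rw [← Real.rpow_natCast, ← Real.rpow_mul hh.le, Real.rpow_neg hh.le, ha]; push_cast; ring_nf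
  have h4 : ((1 - L * h) ^ n)⁻¹ ≤ Real.exp (2 * (L * x)) := by
    have he := exp_neg_two_mul_le hLh0.le hLh
    refine (inv_anti₀ (by positivity) (pow_le_pow_left₀ (by positivity) he n)).trans ?_
    rw [← Real.exp_nat_mul, ← Real.exp_neg, Real.exp_le_exp]
    nlinarith [mul_le_mul_of_nonneg_left hn2 hL.le]
  rw [sub_sub_cancel, Real.mul_rpow hL.le hh.le, h3, h3'] at h1
  have hp : 0 < ((1 - L * h) ^ n)⁻¹ := inv_pos.2 (pow_pos (by linarith) n)
  have h5 : risingCoeff a n ≤ 2 * h / x * (2 ^ (s + 1) * (Real.exp (2 * (L * x)) *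
      ((L ^ (-α)) ^ (s + 1) * ((h ^ α) ^ (s + 1))⁻¹))) := by
    have h6 : (n : ℝ) * risingCoeff a n ≤ 2 ^ (s + 1) * (Real.exp (2 * (L * x)) *
      ((L ^ (-α)) ^ (s + 1) * ((h ^ α) ^ (s + 1))⁻¹)) :=
      h1.trans (by gcongr)
    have h7 : x / (2 * h) * risingCoeff a n ≤ _ :=
      (mul_le_mul_of_nonneg_right hn1 (risingCoeff_nonneg ha0.le n)).trans h6
    rw [div_mul_eq_mul_div, div_le_iff₀ (by positivity)] at h7
    rw [div_mul_eq_mul_div, le_div_iff₀ hx0]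
    linarith
  refine (mul_le_mul_of_nonneg_left (mul_le_mul_of_nonneg_left (mul_le_mul_of_nonneg_left h5
    (by positivity)) (by positivity)) (by positivity)).trans (le_of_eq ?_)
  have := Real.rpow_pos_of_pos hh α
  rw [show (4 : ℝ) = 2 * 2 by norm_num]
  simp only [mul_pow]
  field_simp

lemma abs_primitiveTerm_le (hα : 0 < α) (hlam : 0 < lam) (hK : IsRate α lam K) (hx : 0 ≤ x)
    (s : ℕ) :
    2 ^ s * |primitiveTerm α (-lam) x s| ≤ Real.exp (K * x) * (1 / 2) ^ s := by
  have hK0 := hK.pos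
  rcases hx.eq_or_lt with rfl | hx
  · rcases eq_or_ne s 0 with rfl | hs
    · simp [primitiveTerm]
    · simp [primitiveTerm, Real.zero_rpow hα.ne', hs]
  have hG : 0 < Real.Gamma (α * s + 1) := Real.Gamma_pos_of_pos (by positivity)
  have h1 := inv_Gamma_add_one_le (K := K * x) (a := α * s) (by positivity) (by positivity)
  rw [Real.mul_rpow hK0.le hx.le, ← neg_mul, Real.rpow_mul hK0.le, Real.rpow_mul hx.le,
    Real.rpow_natCast, Real.rpow_natCast, Real.rpow_neg hx.le] at h1
  have hp := Real.rpow_pos_of_pos hx α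
  rw [primitiveTerm, abs_div, abs_pow, abs_mul, abs_neg, abs_of_pos hlam, abs_of_pos hG,
    abs_of_pos hp, div_eq_mul_inv]
  calc _ ≤ 2 ^ s * ((lam * x ^ α) ^ s * (Real.exp (K * x) * ((K ^ (-α)) ^ s * (x ^ α)⁻¹ ^ s))) := by
        gcongr
    _ = Real.exp (K * x) * (2 * lam * K ^ (-α)) ^ s := by
      simp only [mul_pow, inv_pow]; field_simp
    _ ≤ _ := by
      have := Real.rpow_pos_of_pos hK0 (-α)
      gcongr
      nlinarith [hK.le, mul_pos hlam this]

end

/-! ### Densities and primitives with general coefficients `c s = O(2 ^ s)`, covering single kernels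
and their superpositions. -/

section

/-- The density `∑ₛ c_{s+1} ζ ^ (s + 1) x ^ (α (s + 1) - 1) / Γ(α (s + 1))` on `x > 0`. -/
noncomputable def kernelDensity (α : ℝ) (c : ℕ → ℝ) (ζ x : ℝ) : ℝ :=
  if 0 < x then ∑' s : ℕ, c (s + 1) * densityTerm α ζ x s else 0

/-- The function `∑ₛ c_s (ζ x ^ α) ^ s / Γ(α s + 1)`. -/
noncomputable def kernelPrimitive (α : ℝ) (c : ℕ → ℝ) (ζ x : ℝ) : ℝ :=
  ∑' s : ℕ, c s * primitiveTerm α ζ x s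

lemma prabhakarDensity_eq (α γ ζ x : ℝ) :
    prabhakarDensity α γ ζ x = kernelDensity α (risingCoeff γ) ζ x := rfl

variable {α lam K x C : ℝ} {c : ℕ → ℝ}

lemma summable_two_pow_mul_densityTerm (hα : α ∈ Ioc (0 : ℝ) 1) (hlam : 0 < lam) (hx : 0 < x) :
    Summable fun s : ℕ => 2 ^ (s + 1) * |densityTerm α (-lam) x s| := by
  obtain ⟨K, hK⟩ := exists_isRate hα.1 hlam
  exact Summable.of_nonneg_of_le (fun s => by positivity) (abs_densityTerm_le hα hlam hK hx)
    (summable_geometric_two.mul_left _)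

lemma summable_two_pow_mul_primitiveTerm (hα : α ∈ Ioc (0 : ℝ) 1) (hlam : 0 < lam) (hx : 0 ≤ x) :
    Summable fun s : ℕ => 2 ^ s * |primitiveTerm α (-lam) x s| := by
  obtain ⟨K, hK⟩ := exists_isRate hα.1 hlam
  exact Summable.of_nonneg_of_le (fun s => by positivity) (abs_primitiveTerm_le hα.1 hlam hK hx)
    (summable_geometric_two.mul_left _)

lemma abs_mul_densityTerm_le (hα : α ∈ Ioc (0 : ℝ) 1) (hlam : 0 < lam) (hK : IsRate α lam K)
    (hC : 0 ≤ C) (hc : ∀ s, |c s| ≤ C * 2 ^ s) (hx : 0 < x) (s : ℕ) :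
    |c (s + 1) * densityTerm α (-lam) x s| ≤ C * kernelMajorant α lam K x * (1 / 2) ^ s := by
  rw [abs_mul, mul_assoc]
  refine (mul_le_mul_of_nonneg_right (hc (s + 1)) (abs_nonneg _)).trans ?_
  rw [mul_assoc]
  exact mul_le_mul_of_nonneg_left (abs_densityTerm_le hα hlam hK hx s) hC

lemma abs_mul_primitiveTerm_le (hα : α ∈ Ioc (0 : ℝ) 1) (hlam : 0 < lam) (hK : IsRate α lam K)
    (hC : 0 ≤ C) (hc : ∀ s, |c s| ≤ C * 2 ^ s) (hx : 0 ≤ x) (s : ℕ) :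
    |c s * primitiveTerm α (-lam) x s| ≤ C * Real.exp (K * x) * (1 / 2) ^ s := by
  rw [abs_mul, mul_assoc]
  refine (mul_le_mul_of_nonneg_right (hc s) (abs_nonneg _)).trans ?_
  rw [mul_assoc]
  exact mul_le_mul_of_nonneg_left (abs_primitiveTerm_le hα.1 hlam hK hx s) hC

lemma summable_mul_densityTerm (hα : α ∈ Ioc (0 : ℝ) 1) (hlam : 0 < lam)
    (hC : 0 ≤ C) (hc : ∀ s, |c s| ≤ C * 2 ^ s) (hx : 0 < x) :
    Summable fun s => c (s + 1) * densityTerm α (-lam) x s := by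
  obtain ⟨K, hK⟩ := exists_isRate hα.1 hlam
  exact Summable.of_norm_bounded (summable_geometric_two.mul_left _)
    (abs_mul_densityTerm_le hα hlam hK hC hc hx)

lemma summable_mul_primitiveTerm (hα : α ∈ Ioc (0 : ℝ) 1) (hlam : 0 < lam)
    (hC : 0 ≤ C) (hc : ∀ s, |c s| ≤ C * 2 ^ s) (hx : 0 ≤ x) :
    Summable fun s => c s * primitiveTerm α (-lam) x s := by
  obtain ⟨K, hK⟩ := exists_isRate hα.1 hlam
  exact Summable.of_norm_bounded (summable_geometric_two.mul_left _)
    (abs_mul_primitiveTerm_le hα hlam hK hC hc hx)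

lemma abs_tsum_le_of_geometric {f : ℕ → ℝ} {B : ℝ} (h : ∀ s, |f s| ≤ B * (1 / 2) ^ s) :
    |∑' s, f s| ≤ 2 * B := by
  have := tsum_of_norm_bounded (f := f) (hasSum_geometric_two.mul_left B) h
  rwa [Real.norm_eq_abs, mul_comm] at this

lemma abs_kernelDensity_le (hα : α ∈ Ioc (0 : ℝ) 1) (hlam : 0 < lam) (hK : IsRate α lam K)
    (hC : 0 ≤ C) (hc : ∀ s, |c s| ≤ C * 2 ^ s) (hx : 0 < x) :
    |kernelDensity α c (-lam) x| ≤ 2 * (C * kernelMajorant α lam K x) := by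
  rw [kernelDensity, if_pos hx]
  exact abs_tsum_le_of_geometric (abs_mul_densityTerm_le hα hlam hK hC hc hx)

lemma abs_kernelPrimitive_le (hα : α ∈ Ioc (0 : ℝ) 1) (hlam : 0 < lam) (hK : IsRate α lam K)
    (hC : 0 ≤ C) (hc : ∀ s, |c s| ≤ C * 2 ^ s) (hx : 0 ≤ x) :
    |kernelPrimitive α c (-lam) x| ≤ 2 * (C * Real.exp (K * x)) :=
  abs_tsum_le_of_geometric (abs_mul_primitiveTerm_le hα hlam hK hC hc hx)

lemma measurable_densityTerm (α ζ : ℝ) (s : ℕ) : Measurable fun x => densityTerm α ζ x s := by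
  unfold densityTerm; fun_prop

lemma measurable_primitiveTerm (α ζ : ℝ) (s : ℕ) : Measurable fun x => primitiveTerm α ζ x s := by
  unfold primitiveTerm; fun_prop

lemma measurable_kernelDensity (hα : α ∈ Ioc (0 : ℝ) 1) (hlam : 0 < lam)
    (hC : 0 ≤ C) (hc : ∀ s, |c s| ≤ C * 2 ^ s) : Measurable (kernelDensity α c (-lam)) := by
  refine measurable_of_tendsto_metrizable (f := fun N x => if 0 < x then
    ∑ s ∈ Finset.range N, c (s + 1) * densityTerm α (-lam) x s else 0) (fun N => ?_) ?_
  · exact Measurable.ite measurableSet_Ioi (Finset.measurable_fun_sum _ fun s _ =>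
      (measurable_densityTerm _ _ _).const_mul _) measurable_const
  · refine tendsto_pi_nhds.2 fun x => ?_
    by_cases hx : 0 < x
    · simpa [kernelDensity, hx] using
        (summable_mul_densityTerm hα hlam hC hc hx).hasSum.tendsto_sum_nat
    · simp [kernelDensity, hx]

lemma measurable_heaviside_mul_kernelPrimitive (hα : α ∈ Ioc (0 : ℝ) 1) (hlam : 0 < lam)
    (hC : 0 ≤ C) (hc : ∀ s, |c s| ≤ C * 2 ^ s) :
    Measurable fun x => heaviside x * kernelPrimitive α c (-lam) x := by
  refine measurable_of_tendsto_metrizable (f := fun N x => if 0 ≤ x then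
    ∑ s ∈ Finset.range N, c s * primitiveTerm α (-lam) x s else 0) (fun N => ?_) ?_
  · exact Measurable.ite measurableSet_Ici (Finset.measurable_fun_sum _ fun s _ =>
      (measurable_primitiveTerm _ _ _).const_mul _) measurable_const
  · refine tendsto_pi_nhds.2 fun x => ?_
    by_cases hx : 0 ≤ x
    · simpa [heaviside, kernelPrimitive, hx] using
        (summable_mul_primitiveTerm hα hlam hC hc hx).hasSum.tendsto_sum_nat
    · simp [heaviside, hx]

lemma integrableOn_kernelMajorant (hα : 0 < α) (R : ℝ) :
    IntegrableOn (kernelMajorant α lam K) (Ioc 0 R) := by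
  rcases le_total R 0 with hR | hR
  · simp [Ioc_eq_empty_of_le hR]
  rw [← intervalIntegrable_iff_integrableOn_Ioc_of_le hR]
  refine IntervalIntegrable.continuousOn_mul
    (intervalIntegral.intervalIntegrable_rpow' (by linarith)) ?_
  fun_prop

lemma integrableOn_kernelDensity (hα : α ∈ Ioc (0 : ℝ) 1) (hlam : 0 < lam)
    (hC : 0 ≤ C) (hc : ∀ s, |c s| ≤ C * 2 ^ s) (R : ℝ) :
    IntegrableOn (kernelDensity α c (-lam)) (Ioc 0 R) := by
  obtain ⟨K, hK⟩ := exists_isRate hα.1 hlam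
  refine Integrable.mono' (((integrableOn_kernelMajorant (lam := lam) (K := K) hα.1 R).const_mul
    C).const_mul 2) (measurable_kernelDensity hα hlam hC hc).aestronglyMeasurable ?_
  filter_upwards [ae_restrict_mem measurableSet_Ioc] with x hx
  exact abs_kernelDensity_le hα hlam hK hC hc hx.1

lemma integrableOn_heaviside_mul_kernelPrimitive (hα : α ∈ Ioc (0 : ℝ) 1) (hlam : 0 < lam)
    (hC : 0 ≤ C) (hc : ∀ s, |c s| ≤ C * 2 ^ s) (R : ℝ) :
    IntegrableOn (fun x => heaviside x * kernelPrimitive α c (-lam) x) (Ioc 0 R) := by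
  obtain ⟨K, hK⟩ := exists_isRate hα.1 hlam
  refine Integrable.mono' (integrable_const (2 * (C * Real.exp (K * R))))
    (measurable_heaviside_mul_kernelPrimitive hα hlam hC hc).aestronglyMeasurable ?_
  filter_upwards [ae_restrict_mem measurableSet_Ioc] with x hx
  rw [heaviside, if_pos hx.1.le, one_mul]
  refine (abs_kernelPrimitive_le hα hlam hK hC hc hx.1.le).trans ?_
  have := hK.pos
  have := hx.2
  gcongr

/-! ### Regular distributions supported on the half-line -/

lemma locallyIntegrable_of_integrableOn_Ioc {f : ℝ → ℝ} (h0 : ∀ x < 0, f x = 0)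
    (hf : ∀ R : ℝ, IntegrableOn f (Ioc 0 R)) : LocallyIntegrable f := by
  rw [locallyIntegrable_iff]
  intro k hk
  obtain ⟨R, hR⟩ := hk.isBounded.subset_closedBall 0
  have h1 : IntegrableOn f (Iio 0) :=
    (integrableOn_congr_fun (g := fun _ => (0 : ℝ)) (fun x hx => h0 x hx) measurableSet_Iio).2
      integrableOn_zero
  have h2 : IntegrableOn f (Iic 0) := (integrableOn_Iic_iff_integrableOn_Iio (by simp)).2 h1
  refine (h2.union (hf R)).mono_set fun x hx => ?_
  have := hR hx
  rw [mem_closedBall_zero_iff, Real.norm_eq_abs, abs_le] at this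
  rcases le_or_gt x 0 with h | h
  · exact Or.inl h
  · exact Or.inr ⟨h, this.2⟩

/-- Local integrability is needed for the distribution to be given by the integral at all; the two
vanishing conditions then confine the integral to `[0, R]`. -/
lemma regularDist_apply {f : ℝ → ℝ} (h0 : ∀ x < 0, f x = 0)
    (hf : ∀ R : ℝ, IntegrableOn f (Ioc 0 R)) {φ : 𝓓((⊤ : Opens ℝ), ℝ)} {R : ℝ}
    (hR : ∀ x, R < x → φ x = 0) :
    regularDist f φ = ∫ x in Ioc 0 R, φ x * f x := by
  have h1 : regularDist f φ = ∫ x, φ x * f x :=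
    TestFunction.integralAgainstBilinCLM_eq_integral
      ((locallyIntegrable_of_integrableOn_Ioc h0 hf).locallyIntegrableOn _)
  rw [h1, ← integral_Icc_eq_integral_Ioc]
  refine (setIntegral_eq_integral_of_forall_compl_eq_zero fun x hx => ?_).symm
  rcases lt_or_ge x 0 with h | h
  · rw [h0 x h, mul_zero]
  · rw [hR x (not_le.1 fun h' => hx ⟨h, h'⟩), zero_mul]

lemma exists_bound_support (φ : 𝓓((⊤ : Opens ℝ), ℝ)) :
    ∃ R > 0, ∀ x, R < x → φ x = 0 := by
  obtain ⟨R, hR⟩ := φ.hasCompactSupport.isCompact.isBounded.subset_closedBall 0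
  refine ⟨max R 1, by positivity, fun x hx => ?_⟩
  by_contra h
  have := hR (subset_tsupport _ h)
  rw [mem_closedBall_zero_iff, Real.norm_eq_abs] at this
  linarith [le_abs_self x, le_max_left R 1]

lemma exists_bound_abs (φ : 𝓓((⊤ : Opens ℝ), ℝ)) : ∃ M ≥ 0, ∀ x, |φ x| ≤ M := by
  obtain ⟨M, hM⟩ := φ.continuous.bounded_above_of_compact_support φ.hasCompactSupport
  exact ⟨M, (norm_nonneg _).trans (hM 0), hM⟩

lemma hasDerivAt_testFunction (φ : 𝓓((⊤ : Opens ℝ), ℝ)) (x : ℝ) :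
    HasDerivAt φ ((∂_{(1 : ℝ)} φ : 𝓓((⊤ : Opens ℝ), ℝ)) x) x := by
  have h : ((∂_{(1 : ℝ)} φ : 𝓓((⊤ : Opens ℝ), ℝ)) x) = deriv φ x := by
    rw [TestFunction.lineDerivOp_eq_lineDerivCLM ℝ, TestFunction.lineDerivCLM_apply_of_le (by simp),
      lineDeriv, show (fun t : ℝ => φ (x + t • (1 : ℝ))) = fun t => φ (x + t) by simp,
      deriv_comp_const_add, add_zero]
  rw [h]
  exact (φ.contDiff.differentiable (by simp)).differentiableAt.hasDerivAt

end

/-! ### Distributional derivatives of the primitives. -/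

section

variable {α lam K x C : ℝ} {c : ℕ → ℝ}

lemma hasDerivAt_primitiveTerm_succ (hα : 0 < α) (ζ : ℝ) (hx : 0 < x) (s : ℕ) :
    HasDerivAt (fun x => primitiveTerm α ζ x (s + 1)) (densityTerm α ζ x s) x := by
  set a : ℝ := α * ((s : ℝ) + 1) with ha
  have ha0 : 0 < a := by positivity
  have hG := Real.Gamma_pos_of_pos ha0
  have h := ((Real.hasDerivAt_rpow_const (p := a) (Or.inl hx.ne')).const_mul (ζ ^ (s + 1))).div_const
    (Real.Gamma (a + 1))
  have e : ζ ^ (s + 1) * (a * x ^ (a - 1)) / Real.Gamma (a + 1) = densityTerm α ζ x s := by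
    rw [densityTerm, ← ha, Real.Gamma_add_one ha0.ne']
    field_simp
  rw [e] at h
  refine h.congr_of_eventuallyEq ?_
  filter_upwards [lt_mem_nhds hx] with y hy
  rw [primitiveTerm, mul_pow, ← Real.rpow_mul_natCast hy.le]
  push_cast
  rfl

lemma continuous_primitiveTerm (hα : 0 < α) (ζ : ℝ) (s : ℕ) :
    Continuous fun x => primitiveTerm α ζ x s := by
  unfold primitiveTerm
  exact ((continuous_const.mul (Real.continuous_rpow_const hα.le)).pow s).div_const _

lemma intervalIntegrable_densityTerm (hα : 0 < α) (ζ R : ℝ) (s : ℕ) :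
    IntervalIntegrable (fun x => densityTerm α ζ x s) volume 0 R := by
  unfold densityTerm
  refine ((intervalIntegral.intervalIntegrable_rpow' ?_).const_mul _).div_const _
  have : 0 < α * ((s : ℝ) + 1) := by positivity
  linarith

/-- The density may be singular at `0`, so the integration by parts uses only continuity up to the
boundary and an integrable derivative inside. The boundary terms vanish because the primitive is `0`
at `0` and `φ R = 0`. -/
lemma integral_deriv_mul_primitiveTerm_succ (hα : 0 < α) (ζ : ℝ) {R : ℝ} (hR : 0 < R) {φ ψ : ℝ → ℝ}
    (hφ : ∀ x, HasDerivAt φ (ψ x) x) (hψ : Continuous ψ) (hφR : φ R = 0) (s : ℕ) :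
    ∫ x in Ioc 0 R, ψ x * primitiveTerm α ζ x (s + 1) =
      -∫ x in Ioc 0 R, φ x * densityTerm α ζ x s := by
  have hφc : Continuous φ := continuous_iff_continuousAt.2 fun x => (hφ x).continuousAt
  have h := intervalIntegral.integral_mul_deriv_eq_deriv_mul_of_hasDerivAt (a := 0) (b := R)
    (u := fun x => primitiveTerm α ζ x (s + 1)) (v := φ) (u' := fun x => densityTerm α ζ x s)
    (v' := ψ) (continuous_primitiveTerm hα ζ _).continuousOn hφc.continuousOn
    (fun x hx => hasDerivAt_primitiveTerm_succ hα ζ (by simpa [hR.le] using hx.1) s)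
    (fun x _ => hφ x) (intervalIntegrable_densityTerm hα ζ R s) (hψ.intervalIntegrable _ _)
  have h0 : primitiveTerm α ζ 0 (s + 1) = 0 := by
    simp [primitiveTerm, Real.zero_rpow hα.ne']
  rw [hφR, h0, intervalIntegral.integral_of_le hR.le, intervalIntegral.integral_of_le hR.le] at h
  simp only [mul_comm (ψ _), mul_comm (φ _)]
  rw [h]
  ring

lemma hasSum_integral_of_geometric {f : ℕ → ℝ → ℝ} {g : ℝ → ℝ} {S : Set ℝ}
    (hS : MeasurableSet S) (hf : ∀ s, AEStronglyMeasurable (f s) (volume.restrict S))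
    (hg : IntegrableOn g S) (h : ∀ s, ∀ x ∈ S, |f s x| ≤ g x * (1 / 2) ^ s) :
    HasSum (fun s => ∫ x in S, f s x) (∫ x in S, ∑' s, f s x) := by
  have hint (s : ℕ) : IntegrableOn (f s) S := by
    refine Integrable.mono' (hg.mul_const ((1 / 2) ^ s)) (hf s) ?_
    filter_upwards [ae_restrict_mem hS] with x hx using h s x hx
  refine hasSum_integral_of_summable_integral_norm hint ?_
  refine Summable.of_nonneg_of_le (fun s => integral_nonneg fun x => norm_nonneg _) (fun s => ?_)
    (summable_geometric_two.mul_left (∫ x in S, g x))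
  rw [← integral_mul_const]
  exact setIntegral_mono_on (hint s).norm (hg.mul_const _) hS (h s)

lemma integral_mul_kernelDensity (hα : α ∈ Ioc (0 : ℝ) 1) (hlam : 0 < lam)
    (hC : 0 ≤ C) (hc : ∀ s, |c s| ≤ C * 2 ^ s) {φ : ℝ → ℝ} (hφ : Measurable φ) {M : ℝ} (hM : 0 ≤ M)
    (hφM : ∀ x, |φ x| ≤ M) (R : ℝ) :
    HasSum (fun s => c (s + 1) * ∫ x in Ioc 0 R, φ x * densityTerm α (-lam) x s)
      (∫ x in Ioc 0 R, φ x * kernelDensity α c (-lam) x) := by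
  obtain ⟨K, hK⟩ := exists_isRate hα.1 hlam
  have h := hasSum_integral_of_geometric (S := Ioc 0 R)
    (f := fun s x => φ x * (c (s + 1) * densityTerm α (-lam) x s))
    (g := fun x => M * (C * kernelMajorant α lam K x)) measurableSet_Ioc
    (fun s => (hφ.mul ((measurable_densityTerm _ _ _).const_mul _)).aestronglyMeasurable)
    (((integrableOn_kernelMajorant hα.1 R).const_mul _).const_mul _) fun s x hx => by
      rw [abs_mul, mul_assoc M]
      exact mul_le_mul (hφM x) (abs_mul_densityTerm_le hα hlam hK hC hc hx.1 s) (abs_nonneg _) hM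
  convert h using 1
  · ext s
    rw [← integral_const_mul]
    congr 1; ext x; ring
  · refine setIntegral_congr_fun measurableSet_Ioc fun x hx => ?_
    simp only [kernelDensity, if_pos hx.1, tsum_mul_left]

lemma integral_mul_kernelPrimitive (hα : α ∈ Ioc (0 : ℝ) 1) (hlam : 0 < lam)
    (hC : 0 ≤ C) (hc : ∀ s, |c s| ≤ C * 2 ^ s) {φ : ℝ → ℝ} (hφ : Measurable φ) {M : ℝ} (hM : 0 ≤ M)
    (hφM : ∀ x, |φ x| ≤ M) (R : ℝ) :
    HasSum (fun s => c s * ∫ x in Ioc 0 R, φ x * primitiveTerm α (-lam) x s)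
      (∫ x in Ioc 0 R, φ x * (heaviside x * kernelPrimitive α c (-lam) x)) := by
  obtain ⟨K, hK⟩ := exists_isRate hα.1 hlam
  have h := hasSum_integral_of_geometric (S := Ioc 0 R)
    (f := fun s x => φ x * (c s * primitiveTerm α (-lam) x s))
    (g := fun x => M * (C * Real.exp (K * x))) measurableSet_Ioc
    (fun s => (hφ.mul ((measurable_primitiveTerm _ _ _).const_mul _)).aestronglyMeasurable)
    (Continuous.integrableOn_Ioc (by fun_prop)) fun s x hx => by
      rw [abs_mul, mul_assoc M]
      exact mul_le_mul (hφM x) (abs_mul_primitiveTerm_le hα hlam hK hC hc hx.1.le s)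
        (abs_nonneg _) hM
  convert h using 1
  · ext s
    rw [← integral_const_mul]
    congr 1; ext x; ring
  · refine setIntegral_congr_fun measurableSet_Ioc fun x hx => ?_
    simp only [heaviside, kernelPrimitive, if_pos hx.1.le, one_mul, tsum_mul_left]

lemma regularDist_kernelDensity_apply (hα : α ∈ Ioc (0 : ℝ) 1) (hlam : 0 < lam)
    (hC : 0 ≤ C) (hc : ∀ s, |c s| ≤ C * 2 ^ s) {φ : 𝓓((⊤ : Opens ℝ), ℝ)} {R : ℝ}
    (hR : ∀ x, R < x → φ x = 0) :
    regularDist (kernelDensity α c (-lam)) φ =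
      ∫ x in Ioc 0 R, φ x * kernelDensity α c (-lam) x :=
  regularDist_apply (fun x hx => by simp [kernelDensity, hx.not_gt])
    (integrableOn_kernelDensity hα hlam hC hc) hR

/-- The term `s = 0` of the primitive is the step function `c 0 Θ(x)`, whose derivative is `c 0 δ`.
All later terms are continuous at `0` and contribute only their ordinary derivatives; the geometric
majorants justify the termwise work. -/
lemma lineDeriv_regularDist_kernelPrimitive (hα : α ∈ Ioc (0 : ℝ) 1) (hlam : 0 < lam)
    (hC : 0 ≤ C) (hc : ∀ s, |c s| ≤ C * 2 ^ s) (φ : 𝓓((⊤ : Opens ℝ), ℝ)) :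
    (∂_{(1 : ℝ)} (regularDist fun x => heaviside x * kernelPrimitive α c (-lam) x) :
      𝓓'((⊤ : Opens ℝ), ℝ)) φ = c 0 * φ 0 + regularDist (kernelDensity α c (-lam)) φ := by
  set ψ : 𝓓((⊤ : Opens ℝ), ℝ) := ∂_{(1 : ℝ)} φ with hψ
  obtain ⟨R₁, hR₁0, hR₁⟩ := exists_bound_support φ
  obtain ⟨R₂, hR₂0, hR₂⟩ := exists_bound_support ψ
  -- The `+ 1` makes `φ` vanish at `R` itself, not only beyond it.
  set R := max R₁ R₂ + 1 with hRdef
  have hR0 : 0 < R := by positivity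
  have hφR (x : ℝ) (hx : R ≤ x) : φ x = 0 := hR₁ x (by linarith [le_max_left R₁ R₂])
  have hψR (x : ℝ) (hx : R < x) : ψ x = 0 := hR₂ x (by linarith [le_max_right R₁ R₂])
  obtain ⟨M₁, hM₁0, hM₁⟩ := exists_bound_abs φ
  obtain ⟨M₂, hM₂0, hM₂⟩ := exists_bound_abs ψ
  have hd := hasDerivAt_testFunction φ
  rw [Distribution.lineDerivOp_apply_apply, map_neg, ← hψ,
    regularDist_apply (fun x hx => by simp [heaviside, hx])
      (integrableOn_heaviside_mul_kernelPrimitive hα hlam hC hc) hψR,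
    regularDist_kernelDensity_apply hα hlam hC hc fun x hx => hφR x (le_of_lt hx)]
  have h1 := integral_mul_kernelPrimitive hα hlam hC hc ψ.continuous.measurable hM₂0 hM₂ R
  have h2 := integral_mul_kernelDensity hα hlam hC hc φ.continuous.measurable hM₁0 hM₁ R
  have h0 : ∫ x in Ioc 0 R, ψ x * primitiveTerm α (-lam) x 0 = -φ 0 := by
    have := intervalIntegral.integral_eq_sub_of_hasDerivAt (a := 0) (b := R) (fun x _ => hd x)
      (ψ.continuous.intervalIntegrable _ _)
    rw [intervalIntegral.integral_of_le hR0.le, hφR R le_rfl, zero_sub] at this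
    simpa [primitiveTerm] using this
  have h3 := (hasSum_nat_add_iff' 1).2 h1
  have hs (s : ℕ) := integral_deriv_mul_primitiveTerm_succ hα.1 (-lam) hR0 (φ := φ) (ψ := ψ) hd
    ψ.continuous (hφR R le_rfl) s
  simp only [Finset.range_one, Finset.sum_singleton, h0, hs, mul_neg] at h3
  have := h3.unique h2.neg
  linarith

/-! ### Superposition -/

/-- The double family is dominated by the product `A m * (2 ^ s * |w s|)`, so the sums may be
exchanged. -/
lemma hasSum_superposition {b : ℕ → ℕ → ℝ} {A w : ℕ → ℝ} (hb : ∀ m s, |b m s| ≤ A m * 2 ^ s)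
    (hA : Summable A) (hw : Summable fun s => 2 ^ s * |w s|) :
    HasSum (fun m => ∑' s, b m s * w s) (∑' s, (∑' m, b m s) * w s) := by
  have hA0 (m : ℕ) : 0 ≤ A m := by simpa using (abs_nonneg _).trans (hb m 0)
  have hs : Summable (Function.uncurry fun m s => b m s * w s) := by
    refine Summable.of_norm_bounded (hA.mul_of_nonneg hw hA0 fun s => by positivity) ?_
    rintro ⟨m, s⟩
    simp only [Function.uncurry, Real.norm_eq_abs, abs_mul]
    exact (mul_le_mul_of_nonneg_right (hb m s) (abs_nonneg _)).trans (le_of_eq (by ring))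
  have e : ∑' s, (∑' m, b m s) * w s = ∑' m, ∑' s, b m s * w s := by
    rw [← hs.tsum_comm]
    exact tsum_congr fun s => tsum_mul_right.symm
  rw [e]
  exact hs.prod.hasSum

lemma hasSum_superposition_right {b : ℕ → ℕ → ℝ} {A w : ℕ → ℝ}
    (hb : ∀ m s, |b m s| ≤ A m * 2 ^ s) (hA : Summable A) (hw : Summable fun s => 2 ^ s * |w s|) :
    HasSum (fun s => (∑' m, b m s) * w s) (∑' m, ∑' s, b m s * w s) := by
  rw [(hasSum_superposition hb hA hw).tsum_eq]
  refine (Summable.hasSum ?_)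
  refine Summable.of_norm_bounded (hw.mul_left (∑' m, A m)) fun s => ?_
  rw [norm_mul, Real.norm_eq_abs, Real.norm_eq_abs, ← mul_assoc]
  refine mul_le_mul_of_nonneg_right ?_ (abs_nonneg _)
  exact tsum_of_norm_bounded (f := fun m => b m s) (hA.hasSum.mul_right (2 ^ s)) fun m => hb m s

variable {a : ℕ → ℝ}

/-- The weights `s ↦ ∑ₘ aₘ (m)ₛ / s!` of the superposition `∑ₘ aₘ e^m` of Prabhakar kernels. -/
noncomputable def superposedWeight (a : ℕ → ℝ) (s : ℕ) : ℝ := ∑' m : ℕ, a m * risingCoeff m s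

lemma abs_mul_risingCoeff_le (a : ℕ → ℝ) (m s : ℕ) :
    |a m * risingCoeff m s| ≤ |a m| * 2 ^ m * 2 ^ s := by
  rw [abs_mul, abs_of_nonneg (risingCoeff_nonneg (Nat.cast_nonneg m) s), mul_assoc]
  exact mul_le_mul_of_nonneg_left (risingCoeff_natCast_le m s) (abs_nonneg _)

/-- Superposition preserves the growth class `O(2 ^ s)`, so all results for general coefficients
apply to the superposed weights. -/
lemma abs_superposedWeight_le (ha : Summable fun m => |a m| * 2 ^ m) (s : ℕ) :
    |superposedWeight a s| ≤ (∑' m, |a m| * 2 ^ m) * 2 ^ s :=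
  tsum_of_norm_bounded (f := fun m : ℕ => a m * risingCoeff m s) (ha.hasSum.mul_right (2 ^ s))
    fun m => abs_mul_risingCoeff_le a m s

lemma superposedWeight_zero (a : ℕ → ℝ) : superposedWeight a 0 = ∑' m, a m := by
  simp [superposedWeight, risingCoeff_zero_right]

lemma hasSum_kernelDensity_superposed (hα : α ∈ Ioc (0 : ℝ) 1) (hlam : 0 < lam)
    (ha : Summable fun m => |a m| * 2 ^ m) (x : ℝ) :
    HasSum (fun m => a m * kernelDensity α (risingCoeff m) (-lam) x)
      (kernelDensity α (superposedWeight a) (-lam) x) := by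
  by_cases hx : 0 < x
  · simp only [kernelDensity, if_pos hx, ← tsum_mul_left, ← mul_assoc]
    refine hasSum_superposition (b := fun m s => a m * risingCoeff m (s + 1))
      -- The density series uses the coefficient of index `s + 1`, whence the extra factor `2`.
      (A := fun m => 2 * (|a m| * 2 ^ m)) (fun m s => ?_) (ha.mul_left 2) ?_
    · exact (abs_mul_risingCoeff_le a m (s + 1)).trans (le_of_eq (by ring))
    · refine ((summable_two_pow_mul_densityTerm hα hlam hx).mul_left (1 / 2)).congr fun s => ?_
      ring
  · simp [kernelDensity, hx]

lemma hasSum_kernelPrimitive_superposed (hα : α ∈ Ioc (0 : ℝ) 1) (hlam : 0 < lam)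
    (ha : Summable fun m => |a m| * 2 ^ m) (hx : 0 ≤ x) :
    HasSum (fun m => a m * kernelPrimitive α (risingCoeff m) (-lam) x)
      (kernelPrimitive α (superposedWeight a) (-lam) x) := by
  simp only [kernelPrimitive, ← tsum_mul_left, ← mul_assoc]
  exact hasSum_superposition (b := fun m s => a m * risingCoeff m s)
    (A := fun m => |a m| * 2 ^ m) (abs_mul_risingCoeff_le a) ha
    (summable_two_pow_mul_primitiveTerm hα hlam hx)

lemma abs_risingCoeff_natCast_le (m s : ℕ) : |risingCoeff m s| ≤ 2 ^ m * 2 ^ s := by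
  rw [abs_of_nonneg (risingCoeff_nonneg (Nat.cast_nonneg m) s)]
  exact risingCoeff_natCast_le m s

lemma hasSum_regularDist_superposed (hα : α ∈ Ioc (0 : ℝ) 1) (hlam : 0 < lam)
    (ha : Summable fun m => |a m| * 2 ^ m) (φ : 𝓓((⊤ : Opens ℝ), ℝ)) :
    HasSum (fun m : ℕ => a m * regularDist (kernelDensity α (risingCoeff m) (-lam)) φ)
      (regularDist (kernelDensity α (superposedWeight a) (-lam)) φ) := by
  obtain ⟨R, hR0, hR⟩ := exists_bound_support φ
  obtain ⟨M, hM0, hM⟩ := exists_bound_abs φ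
  have hCn : 0 ≤ ∑' m, |a m| * 2 ^ m := tsum_nonneg fun m => by positivity
  rw [regularDist_kernelDensity_apply hα hlam hCn (abs_superposedWeight_le ha) hR]
  simp_rw [fun m : ℕ => regularDist_kernelDensity_apply hα hlam (C := 2 ^ m) (by positivity)
    (abs_risingCoeff_natCast_le m) hR]
  obtain ⟨K, hK⟩ := exists_isRate hα.1 hlam
  have hmeas (m : ℕ) : Measurable (kernelDensity α (risingCoeff m) (-lam)) :=
    measurable_kernelDensity hα hlam (C := 2 ^ m) (by positivity) (abs_risingCoeff_natCast_le m)
  have hmaj := integrableOn_kernelMajorant (lam := lam) (K := K) hα.1 R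
  have hb (m : ℕ) (x : ℝ) (hx : 0 < x) :
      ‖φ x * (a m * kernelDensity α (risingCoeff m) (-lam) x)‖ ≤
        |a m| * 2 ^ m * (2 * M * kernelMajorant α lam K x) := by
    rw [Real.norm_eq_abs, abs_mul, abs_mul]
    have h1 := abs_kernelDensity_le hα hlam hK (C := 2 ^ m) (by positivity)
      (abs_risingCoeff_natCast_le m) hx
    calc _ ≤ M * (|a m| * (2 * (2 ^ m * kernelMajorant α lam K x))) := by
          gcongr
          exact hM x
      _ = _ := by ring
  have hint (m : ℕ) : IntegrableOn
      (fun x => φ x * (a m * kernelDensity α (risingCoeff m) (-lam) x)) (Ioc 0 R) := by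
    refine Integrable.mono' ((hmaj.const_mul (2 * M)).const_mul (|a m| * 2 ^ m))
      (φ.continuous.measurable.mul ((hmeas m).const_mul _)).aestronglyMeasurable ?_
    filter_upwards [ae_restrict_mem measurableSet_Ioc] with x hx using hb m x hx.1
  have h := hasSum_integral_of_summable_integral_norm hint ?_
  · have e1 (m : ℕ) : ∫ x in Ioc 0 R, φ x * (a m * kernelDensity α (risingCoeff m) (-lam) x) =
        a m * ∫ x in Ioc 0 R, φ x * kernelDensity α (risingCoeff m) (-lam) x := by
      rw [← integral_const_mul]
      congr 1; ext x; ring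
    have e2 (x : ℝ) : ∑' m, φ x * (a m * kernelDensity α (risingCoeff m) (-lam) x) =
        φ x * kernelDensity α (superposedWeight a) (-lam) x := by
      rw [tsum_mul_left, (hasSum_kernelDensity_superposed hα hlam ha x).tsum_eq]
    simpa only [e1, e2] using h
  · refine Summable.of_nonneg_of_le (fun s => integral_nonneg fun x => norm_nonneg _) (fun m => ?_)
      (ha.mul_right (∫ x in Ioc 0 R, 2 * M * kernelMajorant α lam K x))
    rw [← integral_const_mul]
    exact setIntegral_mono_on (hint m).norm ((hmaj.const_mul _).const_mul _) measurableSet_Ioc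
      fun x hx => hb m x hx.1

end

/-! ### Convergence of rescaled lattice sequences. -/

section

variable {α lam K x C : ℝ}

/-- The sequences `q h` on the lattices `h ℕ` are given, for small `h`, by superpositions with
uniformly bounded and convergent weights of the coefficients of `(-lam h ^ α (1 - u) ^ (-α)) ^ s`. -/
structure IsLatticeApprox (α lam C : ℝ) (c : ℝ → ℕ → ℝ) (c₀ : ℕ → ℝ) (q : ℝ → ℕ → ℝ) : Prop where
  nonneg : 0 ≤ C
  tendsto : ∀ s, Tendsto (fun h => c h s) (𝓝[>] 0) (𝓝 (c₀ s))
  bound : ∀ᶠ h in 𝓝[>] 0, ∀ s, |c h s| ≤ C * 2 ^ s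
  hasSum : ∀ᶠ h in 𝓝[>] 0, ∀ n,
    HasSum (fun s : ℕ => c h s * ((-(lam * h ^ α)) ^ s * risingCoeff (α * s) n)) (q h n)

lemma tendsto_rpow_zero (hα : 0 < α) : Tendsto (fun h : ℝ => h ^ α) (𝓝[>] 0) (𝓝 0) := by
  have := (Real.continuous_rpow_const hα.le).tendsto 0
  rw [Real.zero_rpow hα.ne'] at this
  exact this.mono_left nhdsWithin_le_nhds

/-- With `n = ⌊x / h⌋₊` the expression equals `(n h) ^ (a - 1) * (n ^ (1 - a) (a)ₙ / n!)`, and `n h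
→ x`. -/
lemma tendsto_lattice_term {a : ℝ} (ha : 0 < a) (hx : 0 < x) :
    Tendsto (fun h : ℝ => 1 / h * (h ^ a * risingCoeff a ⌊x / h⌋₊)) (𝓝[>] 0)
      (𝓝 (x ^ (a - 1) / Real.Gamma a)) := by
  have hinv : Tendsto (fun h : ℝ => h⁻¹) (𝓝[>] 0) atTop := tendsto_inv_nhdsGT_zero
  have hn : Tendsto (fun h : ℝ => ⌊x / h⌋₊) (𝓝[>] 0) atTop := by
    simp only [div_eq_mul_inv]
    exact tendsto_nat_floor_atTop.comp (hinv.const_mul_atTop hx)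
  have h1 : Tendsto (fun h : ℝ => (⌊x / h⌋₊ : ℝ) * h) (𝓝[>] 0) (𝓝 x) := by
    refine ((tendsto_nat_floor_mul_div_atTop hx.le).comp hinv).congr fun h => ?_
    simp [div_eq_mul_inv]
  have h2 := (h1.rpow_const (p := a - 1) (Or.inl hx.ne')).mul ((tendsto_risingCoeff ha).comp hn)
  rw [div_eq_mul_inv]
  refine h2.congr' ?_
  filter_upwards [self_mem_nhdsWithin, hn.eventually_gt_atTop 0] with h (hh : 0 < h) hn0
  have hn' : (0 : ℝ) < ⌊x / h⌋₊ := by exact_mod_cast hn0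
  simp only [Function.comp]
  rw [Real.mul_rpow hn'.le hh.le, ← neg_sub a 1, Real.rpow_neg hn'.le, Real.rpow_sub_one hh.ne']
  have := Real.rpow_pos_of_pos hn' (a - 1)
  field_simp

lemma neg_mul_rpow_pow_succ (α lam : ℝ) {h : ℝ} (hh : 0 < h) (s : ℕ) :
    (-(lam * h ^ α)) ^ (s + 1) = (-lam) ^ (s + 1) * h ^ (α * ((s : ℝ) + 1)) := by
  rw [← neg_mul, mul_pow, ← Real.rpow_mul_natCast hh.le]
  push_cast
  rfl

lemma integrableOn_latticeDensity {h : ℝ} (hh : 0 < h) (q : ℕ → ℝ) (R : ℝ) :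
    IntegrableOn (latticeDensity h q) (Ioc 0 R) := by
  have hm : Measurable (latticeDensity h q) := by
    refine Measurable.ite measurableSet_Ici (Measurable.const_mul ?_ _) measurable_const
    exact (measurable_from_nat (f := q)).comp (Nat.measurable_floor.comp (measurable_id.div_const h))
  refine Integrable.mono' (integrable_const (1 / h * ∑ n ∈ Finset.range (⌊R / h⌋₊ + 1), |q n|))
    hm.aestronglyMeasurable ?_
  filter_upwards [ae_restrict_mem measurableSet_Ioc] with x hx
  rw [latticeDensity, if_pos hx.1.le, norm_mul, Real.norm_of_nonneg (by positivity)]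
  refine mul_le_mul_of_nonneg_left ?_ (by positivity)
  refine Finset.single_le_sum (f := fun n => |q n|) (fun n _ => abs_nonneg _) ?_
  have : ⌊x / h⌋₊ ≤ ⌊R / h⌋₊ := Nat.floor_mono (by have := hx.2; gcongr)
  simpa using Nat.lt_succ_of_le this

namespace IsLatticeApprox

variable {c : ℝ → ℕ → ℝ} {c₀ : ℕ → ℝ} {q : ℝ → ℕ → ℝ}

lemma bound_limit (H : IsLatticeApprox α lam C c c₀ q) (s : ℕ) : |c₀ s| ≤ C * 2 ^ s :=
  le_of_tendsto (H.tendsto s).abs (H.bound.mono fun _ h => h s)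

/-- For `n ≠ 0` the term `s = 0` vanishes, since `(1 - u) ^ 0 = 1` has only a constant coefficient.
This separates the atom at the origin from the density. -/
lemma hasSum_lattice (H : IsLatticeApprox α lam C c c₀ q) : ∀ᶠ h in 𝓝[>] (0 : ℝ), ∀ n, n ≠ 0 →
    HasSum (fun s : ℕ => 1 / h * (c h (s + 1) * ((-lam) ^ (s + 1) * (h ^ (α * ((s : ℝ) + 1)) *
      risingCoeff (α * ((s : ℝ) + 1)) n)))) (1 / h * q h n) := by
  filter_upwards [H.hasSum, self_mem_nhdsWithin] with h hq (hh : 0 < h) n hn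
  have h1 := (hasSum_nat_add_iff' 1).2 (hq n)
  simp only [Finset.range_one, Finset.sum_singleton, CharP.cast_eq_zero, mul_zero,
    risingCoeff_zero_left hn, sub_zero, neg_mul_rpow_pow_succ α lam hh, Nat.cast_add,
    Nat.cast_one] at h1
  simpa only [mul_assoc] using h1.mul_left (1 / h)

lemma term_bound (hα : α ∈ Ioc (0 : ℝ) 1) (hlam : 0 < lam) (hK : IsRate α lam K)
    (H : IsLatticeApprox α lam C c c₀ q) : ∀ᶠ h in 𝓝[>] (0 : ℝ), ∀ x, h ≤ x → ∀ s : ℕ,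
    |1 / h * (c h (s + 1) * ((-lam) ^ (s + 1) * (h ^ (α * ((s : ℝ) + 1)) *
      risingCoeff (α * ((s : ℝ) + 1)) ⌊x / h⌋₊)))| ≤ C * kernelMajorant α lam K x * (1 / 2) ^ s := by
  have hK0 := hK.pos
  have hsmall : ∀ᶠ h in 𝓝[>] (0 : ℝ), h < 1 / (4 * K) :=
    (gt_mem_nhds (by positivity)).filter_mono nhdsWithin_le_nhds
  filter_upwards [H.bound, hsmall, self_mem_nhdsWithin] with h hc hhK (hh : 0 < h) x hx s
  rw [lt_div_iff₀ (by positivity)] at hhK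
  have hα0 := hα.1
  have h1 := lattice_term_le hα hlam hK hh hx (by linarith) s
  have hr := risingCoeff_nonneg (a := α * ((s : ℝ) + 1)) (by positivity) ⌊x / h⌋₊
  have hp := Real.rpow_pos_of_pos hh (α * ((s : ℝ) + 1))
  have e : (lam * h ^ α) ^ (s + 1) = lam ^ (s + 1) * h ^ (α * ((s : ℝ) + 1)) := by
    rw [mul_pow, ← Real.rpow_mul_natCast hh.le]; push_cast; rfl
  rw [e] at h1
  rw [abs_mul, abs_mul, abs_mul, abs_mul, abs_of_nonneg hr, abs_of_pos hp, abs_pow, abs_neg,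
    abs_of_pos hlam, abs_of_pos (by positivity : 0 < 1 / h)]
  calc _ ≤ 1 / h * ((C * 2 ^ (s + 1)) * (lam ^ (s + 1) * (h ^ (α * ((s : ℝ) + 1)) *
        risingCoeff (α * ((s : ℝ) + 1)) ⌊x / h⌋₊))) := by
          gcongr
          exact hc (s + 1)
    _ = C * (1 / h * (2 ^ (s + 1) * (lam ^ (s + 1) * h ^ (α * ((s : ℝ) + 1)) *
        risingCoeff (α * ((s : ℝ) + 1)) ⌊x / h⌋₊))) := by ring
    _ ≤ _ := by
      rw [mul_assoc C]
      exact mul_le_mul_of_nonneg_left h1 H.nonneg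

lemma floor_ne_zero {h : ℝ} (hh : 0 < h) (hx : h ≤ x) : ⌊x / h⌋₊ ≠ 0 := by
  have h1 : 0 < x / (2 * h) := div_pos (hh.trans_le hx) (by positivity)
  exact_mod_cast (h1.trans_le (half_div_le_floor hh hx)).ne'

/-- Pointwise convergence of the rescaled sequences away from the origin. -/
lemma tendsto_pointwise (hα : α ∈ Ioc (0 : ℝ) 1) (hlam : 0 < lam)
    (H : IsLatticeApprox α lam C c c₀ q) (hx : 0 < x) :
    Tendsto (fun h : ℝ => 1 / h * q h ⌊x / h⌋₊) (𝓝[>] 0) (𝓝 (kernelDensity α c₀ (-lam) x)) := by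
  obtain ⟨K, hK⟩ := exists_isRate hα.1 hlam
  have hα0 := hα.1
  have hsmall : ∀ᶠ h in 𝓝[>] (0 : ℝ), h < x :=
    (gt_mem_nhds hx).filter_mono nhdsWithin_le_nhds
  rw [kernelDensity, if_pos hx]
  have key := tendsto_tsum_of_dominated_convergence (𝓕 := 𝓝[>] (0 : ℝ))
    (f := fun h (s : ℕ) => 1 / h * (c h (s + 1) * ((-lam) ^ (s + 1) * (h ^ (α * ((s : ℝ) + 1)) *
      risingCoeff (α * ((s : ℝ) + 1)) ⌊x / h⌋₊)))) (g := fun s => c₀ (s + 1) * densityTerm α (-lam) x s)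
    (summable_geometric_two.mul_left (C * kernelMajorant α lam K x)) (fun s => ?_) ?_
  · refine key.congr' ?_
    filter_upwards [H.hasSum_lattice, hsmall, self_mem_nhdsWithin] with h hq hhx (hh : 0 < h)
    exact (hq _ (floor_ne_zero hh hhx.le)).tsum_eq
  · have ha : 0 < α * ((s : ℝ) + 1) := by positivity
    have := ((H.tendsto (s + 1)).mul_const ((-lam) ^ (s + 1))).mul (tendsto_lattice_term ha hx)
    convert this using 1
    · ext h; ring
    · rw [densityTerm]; congr 1; ring
  · filter_upwards [H.term_bound hα hlam hK, hsmall] with h hb hhx s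
    exact hb x hhx.le s

lemma abs_lattice_le (hα : α ∈ Ioc (0 : ℝ) 1) (hlam : 0 < lam) (hK : IsRate α lam K)
    (H : IsLatticeApprox α lam C c c₀ q) : ∀ᶠ h in 𝓝[>] (0 : ℝ), ∀ x, h ≤ x →
      |1 / h * q h ⌊x / h⌋₊| ≤ 2 * (C * kernelMajorant α lam K x) := by
  filter_upwards [H.hasSum_lattice, H.term_bound hα hlam hK, self_mem_nhdsWithin]
    with h hq hb (hh : 0 < h) x hx
  rw [← (hq _ (floor_ne_zero hh hx)).tsum_eq]
  exact abs_tsum_le_of_geometric (hb x hx)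

/-- At `n = 0` all coefficients `(αs)₀ / 0!` equal `1`, so `q h 0` is a power series in `-(lam h ^
α) → 0`. The threshold `1 / 4` beats the growth `2 ^ s` of the weights. -/
lemma tendsto_zero (hα : 0 < α) (H : IsLatticeApprox α lam C c c₀ q) :
    Tendsto (fun h => q h 0) (𝓝[>] 0) (𝓝 (c₀ 0)) := by
  have h0 : Tendsto (fun h : ℝ => -(lam * h ^ α)) (𝓝[>] 0) (𝓝 0) := by
    simpa using ((tendsto_rpow_zero hα).const_mul lam).neg
  have hsmall : ∀ᶠ h in 𝓝[>] (0 : ℝ), |-(lam * h ^ α)| < 1 / 4 := by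
    have := h0.abs
    rw [abs_zero] at this
    exact this.eventually_lt_const (by norm_num)
  have key := tendsto_tsum_of_dominated_convergence (𝓕 := 𝓝[>] (0 : ℝ))
    (f := fun h (s : ℕ) => c h s * (-(lam * h ^ α)) ^ s) (g := fun s => c₀ s * 0 ^ s)
    (summable_geometric_two.mul_left C) (fun s => (H.tendsto s).mul (h0.pow s)) ?_
  · have e : ∑' s : ℕ, c₀ s * 0 ^ s = c₀ 0 := by
      rw [tsum_eq_single 0 (fun s hs => by simp [hs])]; simp
    rw [e] at key
    refine key.congr' ?_
    filter_upwards [H.hasSum] with h hq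
    simpa [risingCoeff_zero_right] using (hq 0).tsum_eq
  · filter_upwards [H.bound, hsmall] with h hc hh s
    rw [norm_mul, norm_pow, Real.norm_eq_abs, Real.norm_eq_abs]
    calc _ ≤ (C * 2 ^ s) * (1 / 4) ^ s := by
          have := H.nonneg
          gcongr
          exact hc s
      _ = C * (1 / 2) ^ s := by rw [mul_assoc, ← mul_pow]; norm_num

lemma tendsto_average {φ : ℝ → ℝ} (hφ : Continuous φ) :
    Tendsto (fun h : ℝ => 1 / h * ∫ x in Ioc 0 h, φ x) (𝓝[>] 0) (𝓝 (φ 0)) := by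
  have h := (intervalIntegral.integral_hasDerivAt_right (a := 0) (b := 0)
    (hφ.intervalIntegrable _ _) (hφ.stronglyMeasurableAtFilter _ _) hφ.continuousAt)
  have := (hasDerivAt_iff_tendsto_slope.1 h).mono_left
    (nhdsWithin_mono 0 fun y (hy : 0 < y) => hy.ne')
  refine this.congr' ?_
  filter_upwards [self_mem_nhdsWithin] with y (hy : 0 < y)
  simp [slope, intervalIntegral.integral_of_le hy.le]

/-- Convergence of the rescaled sequences as distributions. -/
lemma tendsto_distribution (hα : α ∈ Ioc (0 : ℝ) 1) (hlam : 0 < lam)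
    (H : IsLatticeApprox α lam C c c₀ q) (φ : 𝓓((⊤ : Opens ℝ), ℝ)) :
    Tendsto (fun h => regularDist (latticeDensity h (q h)) φ) (𝓝[>] 0)
      (𝓝 (c₀ 0 * φ 0 + regularDist (kernelDensity α c₀ (-lam)) φ)) := by
  obtain ⟨K, hK⟩ := exists_isRate hα.1 hlam
  obtain ⟨R, hR0, hR⟩ := exists_bound_support φ
  obtain ⟨M, hM0, hM⟩ := exists_bound_abs φ
  have hRs : ∀ᶠ h in 𝓝[>] (0 : ℝ), h < R := (gt_mem_nhds hR0).filter_mono nhdsWithin_le_nhds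
  rw [regularDist_kernelDensity_apply hα hlam H.nonneg H.bound_limit hR]
  have h1 := (H.tendsto_zero hα.1).mul (tendsto_average φ.continuous)
  -- The majorant is available only for `x ≥ h`. The indicator removes the first cell while keeping
  -- the domain of integration fixed; that cell is handled by `h1` and yields `c₀ 0 * φ 0`.
  have h2 : Tendsto (fun h => ∫ x in Ioc 0 R,
      (Ioi h).indicator (fun x => φ x * latticeDensity h (q h) x) x) (𝓝[>] 0)
      (𝓝 (∫ x in Ioc 0 R, φ x * kernelDensity α c₀ (-lam) x)) := by
    refine tendsto_integral_filter_of_dominated_convergence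
      (fun x => M * (2 * (C * kernelMajorant α lam K x))) ?_ ?_ ?_ ?_
    · filter_upwards [self_mem_nhdsWithin] with h (hh : 0 < h)
      exact (φ.continuous.aestronglyMeasurable.mul
        (integrableOn_latticeDensity hh (q h) R).aestronglyMeasurable).indicator measurableSet_Ioi
    · filter_upwards [H.abs_lattice_le hα hlam hK, self_mem_nhdsWithin] with h hb (hh : 0 < h)
      filter_upwards [ae_restrict_mem measurableSet_Ioc] with x hx
      by_cases hxh : h < x
      · rw [indicator_of_mem (by exact hxh), latticeDensity, if_pos hx.1.le, norm_mul]
        exact mul_le_mul (hM x) (hb x hxh.le) (norm_nonneg _) hM0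
      · rw [indicator_of_notMem (by simpa using hxh), norm_zero]
        have := H.nonneg
        have := kernelMajorant_nonneg (α := α) (K := K) hlam hx.1
        positivity
    · exact (((integrableOn_kernelMajorant hα.1 R).const_mul _).const_mul _).const_mul _
    · filter_upwards [ae_restrict_mem measurableSet_Ioc] with x hx
      refine ((H.tendsto_pointwise hα hlam hx.1).const_mul (φ x)).congr' ?_
      filter_upwards [(gt_mem_nhds hx.1).filter_mono nhdsWithin_le_nhds] with h hh
      rw [indicator_of_mem (by exact hh), latticeDensity, if_pos hx.1.le]
  refine (h1.add h2).congr' ?_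
  filter_upwards [self_mem_nhdsWithin, hRs] with h (hh : 0 < h) hhR
  have hint := integrableOn_latticeDensity hh (q h)
  rw [regularDist_apply (fun x hx => by simp [latticeDensity, hx]) hint hR,
    setIntegral_indicator measurableSet_Ioi, Ioc_inter_Ioi, sup_eq_right.2 hh.le,
    ← Ioc_union_Ioc_eq_Ioc hh.le hhR.le]
  have hintφ : IntegrableOn (fun x => φ x * latticeDensity h (q h) x) (Ioc 0 R) :=
    (hint R).bdd_mul φ.continuous.aestronglyMeasurable (ae_of_all _ hM)
  rw [setIntegral_union (Ioc_disjoint_Ioc_of_le le_rfl) measurableSet_Ioc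
    (hintφ.mono_set (Ioc_subset_Ioc_right hhR.le)) (hintφ.mono_set (Ioc_subset_Ioc_left hh.le))]
  congr 1
  -- The open interval excludes `x = h`, where the floor is already `1`.
  rw [← mul_assoc, ← integral_const_mul, integral_Ioc_eq_integral_Ioo, integral_Ioc_eq_integral_Ioo]
  refine setIntegral_congr_fun measurableSet_Ioo fun x hx => ?_
  have : ⌊x / h⌋₊ = 0 := Nat.floor_eq_zero.2 ((div_lt_one hh).2 hx.2)
  simp only [latticeDensity, if_pos hx.1.le, this]
  ring

end IsLatticeApprox

end

section

variable {α lam : ℝ}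

/-! ### Coefficients of generating functions -/

/-- Uniqueness of power series expansions. Analyticity is kept for the later product formula
`gfCoeff_mul`. -/
lemma gfCoeff_eq_of_hasSum {f : ℝ → ℝ} {a : ℕ → ℝ}
    (h : ∀ᶠ u in 𝓝 0, HasSum (fun n => a n * u ^ n) (f u)) :
    AnalyticAt ℝ f 0 ∧ ∀ n, gfCoeff f n = a n := by
  have h1 : HasFPowerSeriesAt f (FormalMultilinearSeries.ofScalars ℝ a) 0 := by
    rw [hasFPowerSeriesAt_iff]
    filter_upwards [h] with u hu
    simpa [FormalMultilinearSeries.coeff_ofScalars, mul_comm] using hu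
  have h2 : AnalyticAt ℝ f 0 := h1.analyticAt
  refine ⟨h2, fun n => ?_⟩
  have h3 := HasFPowerSeriesAt.eq_formalMultilinearSeries h2.hasFPowerSeriesAt h1
  have h4 := congrArg (fun p => FormalMultilinearSeries.coeff p n) h3
  simpa [FormalMultilinearSeries.coeff_ofScalars, gfCoeff] using h4

lemma gfCoeff_congr {f g : ℝ → ℝ} (h : f =ᶠ[𝓝 0] g) (n : ℕ) : gfCoeff f n = gfCoeff g n := by
  rw [gfCoeff, gfCoeff, h.iteratedDeriv_eq]

lemma gfCoeff_mul {f g : ℝ → ℝ} (hf : AnalyticAt ℝ f 0) (hg : AnalyticAt ℝ g 0) (n : ℕ) :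
    gfCoeff (f * g) n = ∑ k ∈ Finset.range (n + 1), gfCoeff f k * gfCoeff g (n - k) := by
  rw [gfCoeff, iteratedDeriv_mul hf.contDiffAt hg.contDiffAt, Finset.sum_div]
  refine Finset.sum_congr rfl fun k hk => ?_
  have hk' : k ≤ n := Nat.lt_succ_iff.1 (Finset.mem_range.1 hk)
  rw [gfCoeff, gfCoeff, Nat.cast_choose ℝ hk']
  have := n.factorial_pos
  have := k.factorial_pos
  have := (n - k).factorial_pos
  field_simp

/-- Taking `r = 1 / 2` gives `(αs)ₙ / n! ≤ 2 ^ n 2 ^ s`. The ratio is then `2 * (1 / 8) * 2 = 1 /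
2`, which explains the threshold `1 / 8`. -/
lemma summable_two_pow_mul_weight (hα : α ∈ Ioc (0 : ℝ) 1) (h0 : 0 ≤ lam) (h1 : lam ≤ 1 / 8)
    (n : ℕ) : Summable fun s : ℕ => 2 ^ s * |(-lam) ^ s * risingCoeff (α * s) n| := by
  refine Summable.of_nonneg_of_le (fun s => by positivity) (fun s => ?_)
    (summable_geometric_two.mul_left (2 ^ n))
  have ha : 0 ≤ α * s := mul_nonneg hα.1.le (Nat.cast_nonneg s)
  have h2 := risingCoeff_le ha (r := 1 / 2) (by norm_num) (by norm_num) n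
  have h3 : ((1 : ℝ) - 1 / 2) ^ (-(α * s)) ≤ 2 ^ s := by
    rw [show (1 : ℝ) - 1 / 2 = 2⁻¹ by norm_num, Real.inv_rpow (by norm_num),
      Real.rpow_neg (by norm_num), inv_inv, ← Real.rpow_natCast]
    exact Real.rpow_le_rpow_of_exponent_le (by norm_num)
      (mul_le_of_le_one_left (Nat.cast_nonneg s) hα.2)
  have h4 : (((1 : ℝ) / 2) ^ n)⁻¹ = 2 ^ n := by rw [one_div, inv_pow, inv_inv]
  rw [h4] at h2
  rw [abs_mul, abs_pow, abs_neg, abs_of_nonneg h0, abs_of_nonneg (risingCoeff_nonneg ha n)]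
  calc (2 : ℝ) ^ s * (lam ^ s * risingCoeff (α * s) n)
      ≤ 2 ^ s * ((1 / 8) ^ s * (2 ^ n * 2 ^ s)) := by
        have := risingCoeff_nonneg ha n
        gcongr
        exact h2.trans (by gcongr)
    _ = 2 ^ n * (1 / 2) ^ s := by
      rw [show (2 : ℝ) ^ s * ((1 / 8) ^ s * (2 ^ n * 2 ^ s)) = 2 ^ n * (2 * (1 / 8) * 2) ^ s by
        simp only [mul_pow]; ring]
      norm_num

/-- Expand the outer power in `-(lam (1 - u) ^ (-α))`, then each `(1 - u) ^ (-αs)` in `u`, and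
exchange the sums. Since all coefficients are nonnegative up to sign, the series of norms is the
same expansion at `|u|` with the signs removed, and it converges because `lam (1 - |u|) ^ (-α) < 1`.
-/
lemma hasSum_generating (hα : α ∈ Ioc (0 : ℝ) 1) (h0 : 0 ≤ lam) (h1 : lam ≤ 1 / 8) (m : ℕ) {u : ℝ}
    (hu : |u| < 1 / 2) :
    HasSum (fun n => (∑' s : ℕ, risingCoeff m s * ((-lam) ^ s * risingCoeff (α * s) n)) * u ^ n)
      (((1 + lam * (1 - u) ^ (-α)) ^ m)⁻¹) := by
  have hgeo {v : ℝ} (hv : |v| < 1 / 2) : |lam * (1 - v) ^ (-α)| < 1 := by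
    have hv' := abs_lt.1 hv
    have h2 : (1 - v) ^ (-α) ≤ 2 := by
      calc (1 - v) ^ (-α) ≤ (1 / 2) ^ (-α) :=
            Real.rpow_le_rpow_of_nonpos (by norm_num) (by linarith) (by linarith [hα.1])
        _ ≤ (1 / 2) ^ (-1 : ℝ) := Real.rpow_le_rpow_of_exponent_ge (by norm_num) (by norm_num)
            (by linarith [hα.2])
        _ = 2 := by rw [Real.rpow_neg_one]; norm_num
    have h3 : 0 ≤ (1 - v) ^ (-α) := Real.rpow_nonneg (by linarith) _
    rw [abs_of_nonneg (by positivity)]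
    nlinarith
  have hpow {v : ℝ} (hv : |v| < 1 / 2) (s : ℕ) : (1 - v) ^ (-(α * s)) = ((1 - v) ^ (-α)) ^ s := by
    rw [← neg_mul, Real.rpow_mul_natCast (by linarith [(abs_lt.1 hv).2])]
  have ha (s : ℕ) : 0 ≤ α * (s : ℝ) := mul_nonneg hα.1.le (Nat.cast_nonneg s)
  have hm (s : ℕ) : 0 ≤ risingCoeff m s := risingCoeff_nonneg (Nat.cast_nonneg m) s
  set F : ℕ → ℕ → ℝ := fun s n => risingCoeff m s * ((-lam) ^ s * risingCoeff (α * s) n) * u ^ n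
    with hF
  have hrow (s : ℕ) : HasSum (F s) (risingCoeff m s * (-(lam * (1 - u) ^ (-α))) ^ s) := by
    have := (hasSum_risingCoeff (α * s) (u := u) (by linarith)).mul_left
      (risingCoeff m s * (-lam) ^ s)
    rw [hpow hu] at this
    have e : F s = fun n => risingCoeff m s * (-lam) ^ s * (risingCoeff (α * s) n * u ^ n) := by
      ext n; simp only [hF]; ring
    rwa [e, ← neg_mul, mul_pow, ← mul_assoc]
  have hu' : |(|u|)| < 1 / 2 := by rwa [abs_abs]
  have hrown (s : ℕ) : HasSum (fun n => ‖F s n‖)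
      (risingCoeff m s * (lam * (1 - |u|) ^ (-α)) ^ s) := by
    have := (hasSum_risingCoeff (α * s) (u := |u|) (by linarith)).mul_left
      (risingCoeff m s * lam ^ s)
    rw [hpow hu'] at this
    have e : (fun n => ‖F s n‖) =
        fun n => risingCoeff m s * lam ^ s * (risingCoeff (α * s) n * |u| ^ n) := by
      ext n
      simp only [hF, norm_mul, norm_pow, Real.norm_eq_abs, abs_neg, abs_of_nonneg h0,
        abs_of_nonneg (hm s), abs_of_nonneg (risingCoeff_nonneg (ha s) n)]
      ring
    rwa [e, mul_pow, ← mul_assoc]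
  have hs : Summable (Function.uncurry F) := by
    refine Summable.of_norm ?_
    refine (summable_prod_of_nonneg (fun p => norm_nonneg _)).2 ⟨fun s => (hrown s).summable, ?_⟩
    simp only [Function.uncurry, (hrown _).tsum_eq]
    exact (hasSum_risingCoeff m (hgeo hu')).summable
  have hcomm := hs.tsum_comm
  have h5 := hs.prod_symm.prod.hasSum
  have h6 : ∑' n, ∑' s, F s n = ((1 + lam * (1 - u) ^ (-α)) ^ m)⁻¹ := by
    rw [hcomm]
    simp only [(hrow _).tsum_eq]
    have h7 := hasSum_risingCoeff m (u := -(lam * (1 - u) ^ (-α))) (by rw [abs_neg]; exact hgeo hu)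
    have h8 : 0 ≤ 1 - -(lam * (1 - u) ^ (-α)) := by linarith [(abs_lt.1 (hgeo hu)).1]
    rw [h7.tsum_eq, Real.rpow_neg h8, Real.rpow_natCast, sub_neg_eq_add]
  have h9 (n : ℕ) : (∑' s : ℕ, risingCoeff m s * ((-lam) ^ s * risingCoeff (α * s) n)) * u ^ n =
      ∑' s, F s n := tsum_mul_right.symm
  simp only [h9, ← h6]
  exact h5

lemma eventually_abs_lt_half : ∀ᶠ u : ℝ in 𝓝 0, |u| < 1 / 2 := by
  have := (continuous_abs (G := ℝ)).tendsto 0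
  rw [abs_zero] at this
  exact this.eventually_lt_const (by norm_num)

lemma discretePrabhakar_eq (hα : α ∈ Ioc (0 : ℝ) 1) (h0 : 0 ≤ lam) (h1 : lam ≤ 1 / 8) (m n : ℕ) :
    discretePrabhakar α m lam n =
      ∑' s : ℕ, risingCoeff m s * ((-lam) ^ s * risingCoeff (α * s) n) :=
  (gfCoeff_eq_of_hasSum (eventually_abs_lt_half.mono fun _ hu =>
    hasSum_generating hα h0 h1 m hu)).2 n

lemma hasSum_discretePrabhakar (hα : α ∈ Ioc (0 : ℝ) 1) (h0 : 0 ≤ lam) (h1 : lam ≤ 1 / 8)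
    (m n : ℕ) : HasSum (fun s : ℕ => risingCoeff m s * ((-lam) ^ s * risingCoeff (α * s) n))
      (discretePrabhakar α m lam n) := by
  rw [discretePrabhakar_eq hα h0 h1]
  refine (Summable.of_norm_bounded
    ((summable_two_pow_mul_weight hα h0 h1 n).mul_left (2 ^ m)) fun s => ?_).hasSum
  rw [norm_mul, ← mul_assoc]
  exact mul_le_mul_of_nonneg_right (abs_risingCoeff_natCast_le m s) (abs_nonneg _)

lemma gML_eventuallyEq (h0 : 0 ≤ lam) :
    gML α lam =ᶠ[𝓝 0] fun u => ((1 + lam * (1 - u) ^ (-α)) ^ 1)⁻¹ := by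
  filter_upwards [eventually_abs_lt_half] with u hu
  have h : 0 < (1 - u) ^ α := Real.rpow_pos_of_pos (by linarith [(abs_lt.1 hu).2]) _
  rw [gML, pow_one, Real.rpow_neg (by linarith [(abs_lt.1 hu).2])]
  field_simp
  rw [add_comm]

lemma discretePrabhakar_zero (α lam : ℝ) (n : ℕ) :
    discretePrabhakar α 0 lam n = if n = 0 then 1 else 0 := by
  rw [discretePrabhakar]
  refine (gfCoeff_eq_of_hasSum (a := fun n => if n = 0 then 1 else 0)
    (Eventually.of_forall fun u => ?_)).2 n
  convert hasSum_ite_eq (0 : ℕ) (1 : ℝ) using 2 with n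
  · split_ifs with h <;> simp [h]
  · simp

/-- Multiplying the generating functions of index `m` and `1` convolves their coefficients, and
`gML` is the one of index `1`. Thus the discrete coefficients are the convolution powers of `g`. -/
lemma discretePrabhakar_succ (hα : α ∈ Ioc (0 : ℝ) 1) (h0 : 0 ≤ lam) (h1 : lam ≤ 1 / 8) (m n : ℕ) :
    discretePrabhakar α (m + 1) lam n = ∑ k ∈ Finset.range (n + 1),
      discretePrabhakar α m lam k * gfCoeff (gML α lam) (n - k) := by
  have hA (m : ℕ) : AnalyticAt ℝ (fun u : ℝ => ((1 + lam * (1 - u) ^ (-α)) ^ m)⁻¹) 0 :=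
    (gfCoeff_eq_of_hasSum (eventually_abs_lt_half.mono fun _ hu =>
      hasSum_generating hα h0 h1 m hu)).1
  simp only [gfCoeff_congr (gML_eventuallyEq h0)]
  have h := gfCoeff_mul (hA m) (hA 1) n
  have e : ((fun u : ℝ => ((1 + lam * (1 - u) ^ (-α)) ^ m)⁻¹) *
      fun u : ℝ => ((1 + lam * (1 - u) ^ (-α)) ^ 1)⁻¹) =
      fun u : ℝ => ((1 + lam * (1 - u) ^ (-α)) ^ (m + 1))⁻¹ := by
    ext u
    simp [pow_succ, mul_comm]
  rw [e] at h
  exact h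

end

section

/-! ### Laplace transforms -/

lemma integrableOn_rpow_mul_exp {a σ : ℝ} (ha : 0 < a) (hσ : 0 < σ) :
    IntegrableOn (fun x : ℝ => x ^ (a - 1) * Real.exp (-(σ * x))) (Ioi 0) := by
  have := integrableOn_rpow_mul_exp_neg_mul_rpow (s := a - 1) (p := 1) (b := σ) (by linarith)
    one_pos hσ
  simpa [neg_mul] using this

lemma norm_exp_mul_rpow {a : ℝ} (s : ℂ) {x : ℝ} (hx : 0 < x) :
    ‖Complex.exp (-s * x) * ((x ^ (a - 1) : ℝ) : ℂ)‖ = x ^ (a - 1) * Real.exp (-(s.re * x)) := by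
  rw [norm_mul, Complex.norm_exp, Complex.norm_real, Real.norm_of_nonneg (Real.rpow_nonneg hx.le _),
    mul_comm]
  simp

lemma integrableOn_exp_mul_rpow {a : ℝ} (ha : 0 < a) {s : ℂ} (hs : 0 < s.re) :
    IntegrableOn (fun x : ℝ => Complex.exp (-s * x) * ((x ^ (a - 1) : ℝ) : ℂ)) (Ioi 0) := by
  refine Integrable.mono' (integrableOn_rpow_mul_exp ha hs) ?_ ?_
  · exact (by fun_prop : Measurable fun x : ℝ =>
      Complex.exp (-s * x) * ((x ^ (a - 1) : ℝ) : ℂ)).aestronglyMeasurable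
  · filter_upwards [ae_restrict_mem measurableSet_Ioi] with x hx
    rw [norm_exp_mul_rpow s hx]

/-- The measure `x ^ (a - 1) dx` on `(0, ∞)`. -/
noncomputable def powerMeasure (a : ℝ) : Measure ℝ :=
  (volume.restrict (Ioi 0)).withDensity fun x => ((x ^ (a - 1)).toNNReal : ENNReal)

lemma integrable_powerMeasure_iff (a : ℝ) (f : ℝ → ℂ) :
    Integrable f (powerMeasure a) ↔ IntegrableOn (fun x => f x * ((x ^ (a - 1) : ℝ) : ℂ)) (Ioi 0) := by
  rw [powerMeasure, integrable_withDensity_iff_integrable_coe_smul (by fun_prop), IntegrableOn]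
  refine integrable_congr ?_
  filter_upwards [ae_restrict_mem measurableSet_Ioi] with x (hx : 0 < x)
  rw [Real.coe_toNNReal _ (Real.rpow_nonneg hx.le _), Complex.real_smul, mul_comm]

lemma integral_powerMeasure (a : ℝ) (f : ℝ → ℂ) :
    ∫ x, f x ∂(powerMeasure a) = ∫ x in Ioi 0, f x * ((x ^ (a - 1) : ℝ) : ℂ) := by
  rw [powerMeasure, integral_withDensity_eq_integral_smul (by fun_prop)]
  refine setIntegral_congr_fun measurableSet_Ioi fun x (hx : 0 < x) => ?_
  simp only [NNReal.smul_def]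
  rw [Real.coe_toNNReal _ (Real.rpow_nonneg hx.le _), Complex.real_smul, mul_comm]

lemma neg_mem_integrableExpSet {a : ℝ} (ha : 0 < a) {t : ℝ} (ht : t < 0) :
    t ∈ ProbabilityTheory.integrableExpSet id (powerMeasure a) := by
  have h := (integrable_powerMeasure_iff a fun x => Complex.exp (-((-t : ℝ) : ℂ) * x)).2
    (integrableOn_exp_mul_rpow ha (by simpa using ht))
  have := h.norm
  simp only [Complex.norm_exp] at this
  simpa [ProbabilityTheory.integrableExpSet] using this

/-- For real `s` this is Euler's integral. Both sides are analytic for `z = -s` in the left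
half-plane, the integral being a complex moment generating function, so the identity theorem extends
the formula from real points near `-1`. -/
lemma integral_exp_mul_rpow {a : ℝ} (ha : 0 < a) {s : ℂ} (hs : 0 < s.re) :
    ∫ x in Ioi (0 : ℝ), Complex.exp (-s * x) * ((x ^ (a - 1) : ℝ) : ℂ) =
      Real.Gamma a * s ^ (-(a : ℂ)) := by
  set U : Set ℂ := {z | z.re < 0} with hU
  have hUopen : IsOpen U := isOpen_lt Complex.continuous_re continuous_const
  have hF : AnalyticOnNhd ℂ (ProbabilityTheory.complexMGF id (powerMeasure a)) U := by
    intro z hz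
    refine ProbabilityTheory.analyticAt_complexMGF ?_
    exact interior_maximal (fun t (ht : t < 0) => neg_mem_integrableExpSet ha ht) isOpen_Iio hz
  have hG : AnalyticOnNhd ℂ (fun z : ℂ => (Real.Gamma a : ℂ) * (-z) ^ (-(a : ℂ))) U := by
    refine DifferentiableOn.analyticOnNhd (fun z hz => ?_) hUopen
    refine (DifferentiableAt.const_mul ?_ _).differentiableWithinAt
    exact DifferentiableAt.cpow_const (by fun_prop) (Or.inl (by simpa [U] using hz))
  have hconn : IsPreconnected U :=
    ((convex_Iio (0 : ℝ)).linear_preimage Complex.reLm).isPreconnected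
  have heq := AnalyticOnNhd.eqOn_of_preconnected_of_frequently_eq hF hG hconn
    (z₀ := ((-1 : ℝ) : ℂ)) (by simp [U]) ?_
  · have h := heq (show -s ∈ U by simpa [U] using hs)
    simp only [neg_neg] at h
    rw [← h, ProbabilityTheory.complexMGF, integral_powerMeasure]
    rfl
  · have h_real : ∃ᶠ x : ℝ in 𝓝[≠] (-1 : ℝ),
        ProbabilityTheory.complexMGF id (powerMeasure a) x =
          (Real.Gamma a : ℂ) * (-(x : ℂ)) ^ (-(a : ℂ)) := by
      refine Eventually.frequently (eventually_nhdsWithin_of_eventually_nhds ?_)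
      filter_upwards [gt_mem_nhds (show (-1 : ℝ) < 0 by norm_num)] with t ht
      have ht' : 0 < -t := by linarith
      rw [ProbabilityTheory.complexMGF, integral_powerMeasure]
      have h := Real.integral_rpow_mul_exp_neg_mul_Ioi ha ht'
      have e : (∫ x in Ioi (0 : ℝ), Complex.exp ((t : ℂ) * (id x : ℝ)) * ((x ^ (a - 1) : ℝ) : ℂ)) =
          ((∫ x in Ioi (0 : ℝ), x ^ (a - 1) * Real.exp (-(-t * x)) : ℝ) : ℂ) := by
        refine Eq.trans ?_ integral_ofReal
        refine setIntegral_congr_fun measurableSet_Ioi fun x _ => ?_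
        simp [mul_comm]
      rw [e, h, one_div, Real.inv_rpow ht'.le, ← Real.rpow_neg ht'.le, mul_comm]
      push_cast [Complex.ofReal_cpow ht'.le]
      rfl
    rw [frequently_iff_seq_forall] at h_real ⊢
    obtain ⟨xs, hx_tendsto, hx_eq⟩ := h_real
    refine ⟨fun n => xs n, ?_, hx_eq⟩
    rw [tendsto_nhdsWithin_iff] at hx_tendsto ⊢
    refine ⟨(Complex.continuous_ofReal.tendsto _).comp hx_tendsto.1, ?_⟩
    filter_upwards [hx_tendsto.2] with n hn
    simpa [← Complex.ofReal_one, ← Complex.ofReal_neg, Complex.ofReal_inj] using hn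

lemma integrable_tsum_of_summable_integral_norm {X E : Type*} [MeasurableSpace X] {μ : Measure X}
    [NormedAddCommGroup E] {F : ℕ → X → E} {f : X → E} (hF : ∀ i, Integrable (F i) μ)
    (hs : Summable fun i => ∫ x, ‖F i x‖ ∂μ) (hf : ∀ᵐ x ∂μ, HasSum (fun i => F i x) (f x)) :
    Integrable f μ := by
  refine ⟨aestronglyMeasurable_of_tendsto_ae atTop (f := fun N x => ∑ i ∈ Finset.range N, F i x)
    (fun N => Finset.aestronglyMeasurable_fun_sum _ fun i _ => (hF i).1)
    (hf.mono fun x hx => hx.tendsto_sum_nat), ?_⟩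
  have h1 : ∫⁻ x, ‖f x‖ₑ ∂μ ≤ ∫⁻ x, ∑' i, ‖F i x‖ₑ ∂μ := by
    refine lintegral_mono_ae (hf.mono fun x hx => ?_)
    rw [← hx.tsum_eq]
    exact enorm_tsum_le_tsum_enorm
  refine lt_of_le_of_lt h1 ?_
  rw [lintegral_tsum fun i => (hF i).1.enorm]
  have h2 (i : ℕ) : ∫⁻ x, ‖F i x‖ₑ ∂μ = ENNReal.ofReal (∫ x, ‖F i x‖ ∂μ) := by
    rw [ofReal_integral_norm_eq_lintegral_enorm (hF i)]
  simp only [h2]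
  rw [← ENNReal.ofReal_tsum_of_nonneg (fun i => integral_nonneg fun x => norm_nonneg _) hs]
  exact ENNReal.ofReal_lt_top

variable {α lam : ℝ}

lemma laplace_densityTerm (hα : 0 < α) (ζ : ℝ) {s : ℂ} (hs : 0 < s.re) (k : ℕ) :
    IntegrableOn (fun x : ℝ => Complex.exp (-s * x) * (densityTerm α ζ x k : ℂ)) (Ioi 0) ∧
    ∫ x in Ioi (0 : ℝ), Complex.exp (-s * x) * (densityTerm α ζ x k : ℂ) =
      (ζ * s ^ (-(α : ℂ))) ^ (k + 1) ∧
    ∫ x in Ioi (0 : ℝ), ‖Complex.exp (-s * x) * (densityTerm α ζ x k : ℂ)‖ =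
      (|ζ| * s.re ^ (-α)) ^ (k + 1) := by
  set a : ℝ := α * ((k : ℝ) + 1) with ha
  have ha0 : 0 < a := by positivity
  have hG := Real.Gamma_pos_of_pos ha0
  have hG' : (Real.Gamma a : ℂ) ≠ 0 := Complex.ofReal_ne_zero.2 hG.ne'
  have e (x : ℝ) : Complex.exp (-s * x) * (densityTerm α ζ x k : ℂ) =
      ((ζ ^ (k + 1) / Real.Gamma a : ℝ) : ℂ) *
        (Complex.exp (-s * x) * ((x ^ (a - 1) : ℝ) : ℂ)) := by
    rw [densityTerm, ← ha]
    push_cast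
    ring
  simp only [e]
  refine ⟨(integrableOn_exp_mul_rpow ha0 hs).const_mul _, ?_, ?_⟩
  · rw [integral_const_mul, integral_exp_mul_rpow ha0 hs, mul_pow, ← Complex.cpow_mul_nat]
    push_cast [ha]
    rw [← neg_mul]
    push_cast [ha] at hG'
    field_simp
  · simp only [norm_mul (((_ : ℝ) : ℂ)) (_ * _)]
    rw [integral_const_mul, setIntegral_congr_fun measurableSet_Ioi
      fun x hx => norm_exp_mul_rpow s hx, Real.integral_rpow_mul_exp_neg_mul_Ioi ha0 hs, mul_pow,
      ← Real.rpow_mul_natCast hs.le, one_div, Real.inv_rpow hs.le, ← Real.rpow_neg hs.le,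
      Complex.norm_real, norm_div, norm_pow, Real.norm_eq_abs, Real.norm_of_nonneg hG.le, ha]
    push_cast
    rw [neg_mul]
    field_simp

/-- The `L¹` norms of the terms form the binomial series at `lam (Re s) ^ (-α)`. This is why the
condition is on `Re s` rather than on `|s|`; the value itself is the binomial series at `lam s ^
(-α)`, which is no larger in modulus. -/
lemma laplace_prabhakarDensity (hα : α ∈ Ioc (0 : ℝ) 1) (hlam : 0 < lam) (m : ℕ) {s : ℂ}
    (hs : 0 < s.re) (hlams : lam < s.re ^ α) :
    IntegrableOn (fun x : ℝ => Complex.exp (-s * x) * (prabhakarDensity α m (-lam) x : ℂ))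
      (Ioi 0) ∧
    1 + ∫ x in Ioi (0 : ℝ), Complex.exp (-s * x) * (prabhakarDensity α m (-lam) x : ℂ) =
      ((1 + (lam : ℂ) * s ^ (-(α : ℂ))) ^ m)⁻¹ := by
  have hq : lam * s.re ^ (-α) < 1 := by
    rw [Real.rpow_neg hs.le, ← div_eq_mul_inv, div_lt_one (Real.rpow_pos_of_pos hs _)]
    exact hlams
  have hq0 : 0 ≤ lam * s.re ^ (-α) := by positivity
  have hz : ‖(lam : ℂ) * s ^ (-(α : ℂ))‖ < 1 := by
    refine lt_of_le_of_lt ?_ hq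
    rw [norm_mul, Complex.norm_real, Real.norm_of_nonneg hlam.le, ← Complex.ofReal_neg,
      Complex.norm_cpow_real]
    exact mul_le_mul_of_nonneg_left (Real.rpow_le_rpow_of_nonpos hs (Complex.re_le_norm s)
      (by linarith [hα.1])) hlam.le
  set F : ℕ → ℝ → ℂ := fun k x => (risingCoeff m (k + 1) : ℂ) *
    (Complex.exp (-s * x) * (densityTerm α (-lam) x k : ℂ)) with hF
  have hm (k : ℕ) : 0 ≤ risingCoeff m (k + 1) := risingCoeff_nonneg (Nat.cast_nonneg m) _
  have hint (k : ℕ) : IntegrableOn (F k) (Ioi 0) :=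
    (laplace_densityTerm hα.1 (-lam) hs k).1.const_mul _
  have hsum : Summable fun k => ∫ x in Ioi (0 : ℝ), ‖F k x‖ := by
    have h := (summable_nat_add_iff 1).2 (hasSum_risingCoeff m (u := lam * s.re ^ (-α))
      (by rwa [abs_of_nonneg hq0])).summable
    refine h.congr fun k => ?_
    simp only [hF, norm_mul ((risingCoeff m (k + 1) : ℝ) : ℂ)]
    rw [integral_const_mul, (laplace_densityTerm hα.1 (-lam) hs k).2.2, abs_neg, abs_of_pos hlam,
      Complex.norm_real, Real.norm_of_nonneg (hm k)]
  have hF_sum (x : ℝ) (hx : 0 < x) :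
      HasSum (fun k => F k x) (Complex.exp (-s * x) * (prabhakarDensity α m (-lam) x : ℂ)) := by
    have h := (summable_mul_densityTerm (c := risingCoeff m) hα hlam (C := 2 ^ m) (by positivity)
      (abs_risingCoeff_natCast_le m) hx).hasSum
    rw [prabhakarDensity_eq, kernelDensity, if_pos hx]
    have h' := (Complex.hasSum_ofReal.2 h).mul_left (Complex.exp (-s * x))
    have e : (fun k => F k x) = fun k => Complex.exp (-s * x) *
        ((risingCoeff m (k + 1) * densityTerm α (-lam) x k : ℝ) : ℂ) := by
      ext k; simp only [hF]; push_cast; ring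
    rw [e]
    exact h'
  have hae : ∀ᵐ x ∂(volume.restrict (Ioi (0 : ℝ))), HasSum (fun k => F k x)
      (Complex.exp (-s * x) * (prabhakarDensity α m (-lam) x : ℂ)) := by
    filter_upwards [ae_restrict_mem measurableSet_Ioi] with x hx using hF_sum x hx
  refine ⟨integrable_tsum_of_summable_integral_norm hint hsum hae, ?_⟩
  have h1 := hasSum_integral_of_summable_integral_norm hint hsum
  rw [integral_congr_ae (hae.mono fun x hx => hx.tsum_eq)] at h1
  have h2 := (hasSum_nat_add_iff' 1).2 (hasSum_risingCoeff_complex m hz)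
  simp only [Finset.range_one, Finset.sum_singleton, pow_zero, mul_one, risingCoeff_zero_right,
    Complex.ofReal_one] at h2
  have h3 (k : ℕ) : ∫ x in Ioi (0 : ℝ), F k x =
      (risingCoeff m (k + 1) : ℂ) * (-(lam * s ^ (-(α : ℂ)))) ^ (k + 1) := by
    simp only [hF]
    rw [integral_const_mul, (laplace_densityTerm hα.1 (-lam) hs k).2.1]
    push_cast
    ring
  simp only [h3] at h1
  rw [h1.unique h2]
  ring

end

section

/-! ### Fractional integrals -/

lemma integral_beta {u v t : ℝ} (hu : 0 < u) (hv : 0 < v) (ht : 0 < t) :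
    ∫ x in Ioc 0 t, (t - x) ^ (v - 1) * x ^ (u - 1) =
      t ^ (u + v - 1) * (Real.Gamma u * Real.Gamma v / Real.Gamma (u + v)) := by
  have h := Complex.betaIntegral_scaled u v ht
  have hb : Complex.betaIntegral u v =
      ((Real.Gamma u * Real.Gamma v / Real.Gamma (u + v) : ℝ) : ℂ) := by
    have hG : Complex.Gamma (u + v : ℂ) ≠ 0 :=
      Complex.Gamma_ne_zero_of_re_pos (by simpa using add_pos hu hv)
    have := Complex.Gamma_mul_Gamma_eq_betaIntegral (s := u) (t := v) (by simpa) (by simpa)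
    push_cast [← Complex.Gamma_ofReal]
    rw [this]
    field_simp
  rw [hb, intervalIntegral.integral_of_le ht.le] at h
  have e : (∫ x in Ioc 0 t, (x : ℂ) ^ ((u : ℂ) - 1) * ((t : ℂ) - x) ^ ((v : ℂ) - 1)) =
      ((∫ x in Ioc 0 t, (t - x) ^ (v - 1) * x ^ (u - 1) : ℝ) : ℂ) := by
    refine Eq.trans ?_ integral_ofReal
    refine setIntegral_congr_fun measurableSet_Ioc fun x hx => ?_
    have h1 : 0 ≤ t - x := by linarith [hx.2]
    simp only [Complex.coe_algebraMap]
    push_cast [Complex.ofReal_cpow h1, Complex.ofReal_cpow hx.1.le]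
    ring
  rw [e] at h
  have h2 : (t : ℂ) ^ ((u : ℂ) + v - 1) = ((t ^ (u + v - 1) : ℝ) : ℂ) := by
    push_cast [Complex.ofReal_cpow ht.le]; rfl
  rw [h2] at h
  exact_mod_cast h

/-- A non-integrable function would have integral `0`, whereas the Beta value is positive. -/
lemma integrableOn_beta {u v t : ℝ} (hu : 0 < u) (hv : 0 < v) (ht : 0 < t) :
    IntegrableOn (fun x => (t - x) ^ (v - 1) * x ^ (u - 1)) (Ioc 0 t) := by
  by_contra h
  have h1 := integral_beta hu hv ht
  rw [integral_undef h] at h1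
  have := Real.Gamma_pos_of_pos hu
  have := Real.Gamma_pos_of_pos hv
  have := Real.Gamma_pos_of_pos (add_pos hu hv)
  have : 0 < t ^ (u + v - 1) * (Real.Gamma u * Real.Gamma v / Real.Gamma (u + v)) := by positivity
  linarith

lemma integrableOn_sub_rpow {β t : ℝ} (hβ : 0 < β) (ht : 0 < t) :
    IntegrableOn (fun s => (t - s) ^ (β - 1)) (Ioc 0 t) := by
  simpa using integrableOn_beta one_pos hβ ht

lemma integrableOn_sub_rpow_mul {β t : ℝ} (hβ : 0 < β) (ht : 0 < t) {f : ℝ → ℝ}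
    (hf : ContinuousOn f (Ici 0)) : IntegrableOn (fun s => (t - s) ^ (β - 1) * f s) (Ioc 0 t) := by
  have hc : ContinuousOn f (Icc 0 t) := hf.mono Icc_subset_Ici_self
  obtain ⟨M, hM⟩ := isCompact_Icc.exists_bound_of_continuousOn hc
  refine Integrable.mul_bdd (c := M) (integrableOn_sub_rpow hβ ht)
    ((hc.mono Ioc_subset_Icc_self).aestronglyMeasurable measurableSet_Ioc) ?_
  filter_upwards [ae_restrict_mem measurableSet_Ioc] with x hx using hM x (Ioc_subset_Icc_self hx)

/-- The Riemann–Liouville integral of order `β`. -/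
noncomputable def fracIntegral (β : ℝ) (f : ℝ → ℝ) (t : ℝ) : ℝ :=
  (Real.Gamma β)⁻¹ * ∫ s in Ioc 0 t, (t - s) ^ (β - 1) * f s

lemma rpow_pow_eq {β t : ℝ} (ht : 0 ≤ t) (m : ℕ) : (t ^ β) ^ m = t ^ (β * m) :=
  (Real.rpow_mul_natCast ht β m).symm

lemma fracIntegral_pow {β t : ℝ} (hβ : 0 < β) (ht : 0 < t) (m : ℕ) :
    fracIntegral β (fun s => (s ^ β) ^ m / Real.Gamma (β * m + 1)) t =
      (t ^ β) ^ (m + 1) / Real.Gamma (β * (m + 1 : ℕ) + 1) := by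
  have hu : 0 < β * m + 1 := by positivity
  have h := integral_beta hu hβ ht
  have e : ∫ s in Ioc 0 t, (t - s) ^ (β - 1) * ((s ^ β) ^ m / Real.Gamma (β * m + 1)) =
      (∫ s in Ioc 0 t, (t - s) ^ (β - 1) * s ^ (β * m + 1 - 1)) * (Real.Gamma (β * m + 1))⁻¹ := by
    rw [← integral_mul_const]
    refine setIntegral_congr_fun measurableSet_Ioc fun s hs => ?_
    simp only [rpow_pow_eq hs.1.le, add_sub_cancel_right, div_eq_mul_inv, mul_assoc]
  have h1 := Real.Gamma_pos_of_pos hu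
  have h2 := Real.Gamma_pos_of_pos hβ
  have e1 : β * m + 1 + β - 1 = β * (m + 1 : ℕ) := by push_cast; ring
  have e2 : β * m + 1 + β = β * (m + 1 : ℕ) + 1 := by push_cast; ring
  rw [fracIntegral, e, h, rpow_pow_eq ht.le, e1, e2]
  field_simp

/-- The exponents `β - 1` and `-β` add to `-1`, so the Beta integral does not depend on the length
of the interval. This is Abel's inversion kernel. -/
lemma integral_sub_rpow_mul_sub_rpow {β t τ : ℝ} (hβ : β ∈ Ioo (0 : ℝ) 1) (h : τ < t) :
    IntegrableOn (fun s => (t - s) ^ (β - 1) * (s - τ) ^ (-β)) (Ioc τ t) ∧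
    ∫ s in Ioc τ t, (t - s) ^ (β - 1) * (s - τ) ^ (-β) = Real.Gamma β * Real.Gamma (1 - β) := by
  have h1 : 0 < 1 - β := by linarith [hβ.2]
  have h0 : 0 < t - τ := by linarith
  have hi := integrableOn_beta h1 hβ.1 h0
  have hv := integral_beta h1 hβ.1 h0
  rw [← intervalIntegrable_iff_integrableOn_Ioc_of_le h0.le] at hi
  rw [← intervalIntegral.integral_of_le h0.le] at hv
  have e (x : ℝ) : (t - τ - (x - τ)) ^ (β - 1) * (x - τ) ^ (1 - β - 1) =
      (t - x) ^ (β - 1) * (x - τ) ^ (-β) := by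
    rw [sub_sub_sub_cancel_right, show 1 - β - 1 = -β by ring]
  constructor
  · rw [← intervalIntegrable_iff_integrableOn_Ioc_of_le h.le]
    have := hi.comp_sub_right τ
    simpa only [e, zero_add, sub_add_cancel] using this
  · rw [← intervalIntegral.integral_of_le h.le]
    have := intervalIntegral.integral_comp_sub_right
      (fun x => (t - τ - x) ^ (β - 1) * x ^ (1 - β - 1)) (a := τ) (b := t) τ
    simp only [e, sub_self] at this
    rw [this, hv]
    simp [mul_comm]

/-- The fractional integral of the Caputo kernel applied to `f` is the integral of `f`. -/
lemma fracIntegral_caputo {β t : ℝ} (hβ : β ∈ Ioo (0 : ℝ) 1) {f : ℝ → ℝ}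
    (hf : IntegrableOn f (Ioc 0 t)) :
    fracIntegral β (fun s => (Real.Gamma (1 - β))⁻¹ * ∫ τ in Ioc 0 s, (s - τ) ^ (-β) * f τ) t =
      ∫ τ in Ioc 0 t, f τ := by
  -- The kernel on the triangle `τ < s`, extended by zero so that Fubini applies on a square.
  set k : ℝ × ℝ → ℝ := fun z => if z.2 < z.1 then (t - z.1) ^ (β - 1) * (z.1 - z.2) ^ (-β) else 0
    with hk
  have hkm : Measurable k := by
    refine Measurable.ite (measurableSet_lt measurable_snd measurable_fst) ?_ measurable_const
    fun_prop
  have hk0 (z : ℝ × ℝ) (hz : z.1 ≤ t) : 0 ≤ k z := by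
    simp only [hk]
    split_ifs with h
    · exact mul_nonneg (Real.rpow_nonneg (by linarith) _) (Real.rpow_nonneg (by linarith) _)
    · exact le_rfl
  have hG := Real.Gamma_pos_of_pos hβ.1
  have hG' := Real.Gamma_pos_of_pos (s := 1 - β) (by linarith [hβ.2])
  set μ := volume.restrict (Ioc 0 t) with hμ
  have hcol (τ : ℝ) (hτ : τ ∈ Ioo 0 t) : Integrable (fun s => k (s, τ)) μ ∧
      ∫ s, k (s, τ) ∂μ = Real.Gamma β * Real.Gamma (1 - β) := by
    have e : (fun s => k (s, τ)) =
        (Ioi τ).indicator fun s => (t - s) ^ (β - 1) * (s - τ) ^ (-β) := by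
      ext s; simp [hk, indicator]
    have h := integral_sub_rpow_mul_sub_rpow hβ hτ.2
    have hset : Ioi τ ∩ Ioc 0 t = Ioc τ t := by
      ext s; simp only [mem_inter_iff, mem_Ioi, mem_Ioc]
      exact ⟨fun h => ⟨h.1, h.2.2⟩, fun h => ⟨h.1, hτ.1.trans h.1, h.2⟩⟩
    rw [e]
    constructor
    · rw [integrable_indicator_iff measurableSet_Ioi, IntegrableOn, hμ,
        Measure.restrict_restrict measurableSet_Ioi, hset]
      exact h.1
    · rw [integral_indicator measurableSet_Ioi, hμ,
        Measure.restrict_restrict measurableSet_Ioi, hset, h.2]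
  -- The endpoint `τ = t` is discarded: its column is empty and does not have the Abel value.
  have hae : ∀ᵐ τ ∂μ, τ ∈ Ioo 0 t := by
    rw [hμ, ← restrict_Ioo_eq_restrict_Ioc]
    exact ae_restrict_mem measurableSet_Ioo
  have hint : Integrable (fun z : ℝ × ℝ => k z * f z.2) (μ.prod μ) := by
    have hmeas : AEStronglyMeasurable (fun z : ℝ × ℝ => k z * f z.2) (μ.prod μ) :=
      hkm.aestronglyMeasurable.mul hf.aestronglyMeasurable.comp_snd
    rw [integrable_prod_iff' hmeas]
    constructor
    · filter_upwards [hae] with τ hτ using (hcol τ hτ).1.mul_const _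
    · refine (hf.norm.const_mul (Real.Gamma β * Real.Gamma (1 - β))).congr ?_
      filter_upwards [hae] with τ hτ
      rw [← (hcol τ hτ).2, ← integral_mul_const]
      refine setIntegral_congr_fun measurableSet_Ioc fun s hs => ?_
      simp only [norm_mul]
      rw [Real.norm_of_nonneg (hk0 (s, τ) hs.2)]
  have hswap := integral_integral_swap (f := fun s τ => k (s, τ) * f τ) hint
  have hl : ∫ s, ∫ τ, k (s, τ) * f τ ∂μ ∂μ =
      ∫ s in Ioc 0 t, (t - s) ^ (β - 1) * ∫ τ in Ioc 0 s, (s - τ) ^ (-β) * f τ := by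
    refine setIntegral_congr_fun measurableSet_Ioc fun s hs => ?_
    have e : (fun τ => k (s, τ) * f τ) =
        (Iio s).indicator fun τ => (t - s) ^ (β - 1) * ((s - τ) ^ (-β) * f τ) := by
      ext τ; simp [hk, indicator, mul_assoc]
    have hset : Iio s ∩ Ioc 0 t = Ioo 0 s := by
      ext τ; simp only [mem_inter_iff, mem_Iio, mem_Ioc, mem_Ioo]
      exact ⟨fun h => ⟨h.2.1, h.1⟩, fun h => ⟨h.2, h.1, h.2.le.trans hs.2⟩⟩
    simp only [e]
    rw [integral_indicator measurableSet_Iio, hμ, Measure.restrict_restrict measurableSet_Iio, hset,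
      integral_const_mul, integral_Ioc_eq_integral_Ioo]
  have hr : ∫ τ, ∫ s, k (s, τ) * f τ ∂μ ∂μ =
      Real.Gamma β * Real.Gamma (1 - β) * ∫ τ in Ioc 0 t, f τ := by
    rw [← integral_const_mul]
    refine integral_congr_ae ?_
    filter_upwards [hae] with τ hτ
    rw [integral_mul_const, (hcol τ hτ).2]
  rw [fracIntegral]
  simp only [mul_left_comm _ (Real.Gamma (1 - β))⁻¹]
  rw [integral_const_mul, ← hl, hswap, hr]
  field_simp
  rfl

/-- A solution of `d^β f / dt^β = F` solves the corresponding Volterra equation. -/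
lemma eq_add_fracIntegral_of_caputoDeriv {β : ℝ} (hβ : β ∈ Ioc (0 : ℝ) 1) {f F : ℝ → ℝ}
    (hc : ContinuousOn f (Ici 0)) (hd : ContDiffOn ℝ 1 f (Ioi 0))
    (hi : ∀ T : ℝ, IntegrableOn (deriv f) (Ioc 0 T)) (hF : ∀ t, 0 < t → caputoDeriv β f t = F t)
    {t : ℝ} (ht : 0 < t) : f t = f 0 + fracIntegral β F t := by
  have h1 : ∫ τ in Ioc 0 t, deriv f τ = f t - f 0 := by
    rw [← intervalIntegral.integral_of_le ht.le]
    refine intervalIntegral.integral_eq_sub_of_hasDerivAt_of_le ht.le (hc.mono Icc_subset_Ici_self)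
      (fun x hx => ?_) ((intervalIntegrable_iff_integrableOn_Ioc_of_le ht.le).2 (hi t))
    exact ((hd.differentiableOn (by simp)).differentiableAt (Ioi_mem_nhds hx.1)).hasDerivAt
  rcases eq_or_lt_of_le hβ.2 with rfl | hβ1
  · have : fracIntegral 1 F t = ∫ τ in Ioc 0 t, deriv f τ := by
      rw [fracIntegral, Real.Gamma_one, inv_one, one_mul]
      refine setIntegral_congr_fun measurableSet_Ioc fun s hs => ?_
      simp [← hF s hs.1, caputoDeriv]
    rw [this, h1]; ring
  · have h2 := fracIntegral_caputo ⟨hβ.1, hβ1⟩ (hi t)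
    have h3 : fracIntegral β F t = fracIntegral β
        (fun s => (Real.Gamma (1 - β))⁻¹ * ∫ τ in Ioc 0 s, (s - τ) ^ (-β) * deriv f τ) t := by
      rw [fracIntegral, fracIntegral]
      congr 1
      refine setIntegral_congr_fun measurableSet_Ioc fun s hs => ?_
      simp only [← hF s hs.1, caputoDeriv, if_neg hβ1.ne, intervalIntegral.integral_of_le hs.1.le]
    rw [h3, h2, h1]; ring

/-! ### Lower triangular fractional systems -/

/-- The `m`-fold convolution power of `g`, computed recursively. -/
def IsConvPower (g : ℕ → ℝ) (D : ℕ → ℕ → ℝ) : Prop :=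
  (∀ n, D 0 n = if n = 0 then 1 else 0) ∧
    ∀ m n, D (m + 1) n = ∑ k ∈ Finset.range (n + 1), D m k * g (n - k)

lemma sum_abs_reflect_le (g : ℕ → ℝ) {n N : ℕ} (h : n ≤ N) :
    ∑ k ∈ Finset.range (n + 1), |g (n - k)| ≤ ∑ k ∈ Finset.range (N + 1), |g k| := by
  rw [Finset.sum_flip fun k => |g k|]
  exact Finset.sum_le_sum_of_subset_of_nonneg (Finset.range_mono (by omega))
    fun k _ _ => abs_nonneg _

/-- The system is lower triangular, so the first `N + 1` components form a closed finite system with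
operator norm at most `∑_{k ≤ N} |g k|`. -/
lemma abs_conv_le {g v : ℕ → ℝ} {V : ℝ} (hV : 0 ≤ V) {n N : ℕ} (h : n ≤ N)
    (hv : ∀ k ≤ N, |v k| ≤ V) : |∑ k ∈ Finset.range (n + 1), v k * g (n - k)| ≤
      V * ∑ k ∈ Finset.range (N + 1), |g k| := by
  refine (Finset.abs_sum_le_sum_abs _ _).trans ?_
  refine le_trans ?_ (mul_le_mul_of_nonneg_left (sum_abs_reflect_le g h) hV)
  rw [Finset.mul_sum]
  refine Finset.sum_le_sum fun k hk => ?_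
  rw [abs_mul]
  exact mul_le_mul_of_nonneg_right (hv k (by have := Finset.mem_range.1 hk; omega)) (abs_nonneg _)

lemma IsConvPower.abs_le {g : ℕ → ℝ} {D : ℕ → ℕ → ℝ} (hD : IsConvPower g D) (N m n : ℕ)
    (h : n ≤ N) : |D m n| ≤ (∑ k ∈ Finset.range (N + 1), |g k|) ^ m := by
  induction m generalizing n with
  | zero => rw [hD.1, pow_zero]; split_ifs <;> simp
  | succ m ih =>
    rw [hD.2, pow_succ]
    exact abs_conv_le (pow_nonneg (Finset.sum_nonneg fun k _ => abs_nonneg _) m) h fun k hk => ih k hk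

variable {β c : ℝ} {g : ℕ → ℝ} {D : ℕ → ℕ → ℝ} {p : ℕ → ℝ → ℝ}

/-- The `m`-th term of the Mittag-Leffler series of the solution. -/
noncomputable def seriesTerm (β c : ℝ) (D : ℕ → ℕ → ℝ) (n : ℕ) (t : ℝ) (m : ℕ) : ℝ :=
  (c * t ^ β) ^ m / Real.Gamma (β * m + 1) * D m n

lemma continuousOn_seriesTerm (hβ : 0 < β) (n m : ℕ) :
    ContinuousOn (fun t => seriesTerm β c D n t m) (Ici 0) := by
  unfold seriesTerm
  exact ((((continuous_const.mul (Real.continuous_rpow_const hβ.le)).pow m).div_const _).mul_const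
    _).continuousOn

lemma conv_seriesTerm (hD : IsConvPower g D) (n m : ℕ) (t : ℝ) :
    ∑ k ∈ Finset.range (n + 1), seriesTerm β c D k t m * g (n - k) =
      c ^ m * D (m + 1) n * ((t ^ β) ^ m / Real.Gamma (β * m + 1)) := by
  simp only [seriesTerm, mul_assoc]
  rw [← Finset.mul_sum, ← hD.2, mul_pow]
  ring

lemma fracIntegral_const_mul (a : ℝ) (f : ℝ → ℝ) (t : ℝ) :
    fracIntegral β (fun s => a * f s) t = a * fracIntegral β f t := by
  simp only [fracIntegral, mul_left_comm _ a]
  rw [integral_const_mul]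
  ring

lemma fracIntegral_sum (hβ : 0 < β) {t : ℝ} (ht : 0 < t) {f : ℕ → ℝ → ℝ} (S : Finset ℕ)
    (hf : ∀ i, ContinuousOn (f i) (Ici 0)) :
    fracIntegral β (fun s => ∑ i ∈ S, f i s) t = ∑ i ∈ S, fracIntegral β (f i) t := by
  simp only [fracIntegral, Finset.mul_sum]
  rw [integral_finsetSum _ fun i _ => integrableOn_sub_rpow_mul hβ ht (hf i), Finset.mul_sum]

lemma fracIntegral_sub (hβ : 0 < β) {t : ℝ} (ht : 0 < t) {f₁ f₂ : ℝ → ℝ}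
    (h₁ : ContinuousOn f₁ (Ici 0)) (h₂ : ContinuousOn f₂ (Ici 0)) :
    fracIntegral β (fun s => f₁ s - f₂ s) t = fracIntegral β f₁ t - fracIntegral β f₂ t := by
  simp only [fracIntegral, mul_sub]
  rw [integral_sub (integrableOn_sub_rpow_mul hβ ht h₁) (integrableOn_sub_rpow_mul hβ ht h₂), mul_sub]

lemma abs_fracIntegral_le (hβ : 0 < β) {t : ℝ} (ht : 0 < t) {f w : ℝ → ℝ}
    (hw : ContinuousOn w (Ici 0)) (h : ∀ s ∈ Ioc 0 t, |f s| ≤ w s) :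
    |fracIntegral β f t| ≤ fracIntegral β w t := by
  have hG := Real.Gamma_pos_of_pos hβ
  rw [fracIntegral, fracIntegral, abs_mul, abs_of_pos (inv_pos.2 hG)]
  refine mul_le_mul_of_nonneg_left ?_ (inv_pos.2 hG).le
  rw [← Real.norm_eq_abs]
  refine norm_integral_le_of_norm_le (integrableOn_sub_rpow_mul hβ ht hw) ?_
  filter_upwards [ae_restrict_mem measurableSet_Ioc] with s hs
  have h0 : 0 ≤ (t - s) ^ (β - 1) := Real.rpow_nonneg (by linarith [hs.2]) _
  rw [norm_mul, Real.norm_of_nonneg h0]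
  exact mul_le_mul_of_nonneg_left (h s hs) h0

/-- The Volterra map sends one partial sum to the next, by `fracIntegral_pow` and the convolution
recursion. -/
lemma partialSum_succ (hβ : 0 < β) (hD : IsConvPower g D) {t : ℝ} (ht : 0 < t) (M n : ℕ) :
    ∑ m ∈ Finset.range (M + 1), seriesTerm β c D n t m = (if n = 0 then 1 else 0) +
      fracIntegral β (fun s => c * ∑ k ∈ Finset.range (n + 1),
        (∑ m ∈ Finset.range M, seriesTerm β c D k s m) * g (n - k)) t := by
  have e (s : ℝ) : ∑ k ∈ Finset.range (n + 1),
      (∑ m ∈ Finset.range M, seriesTerm β c D k s m) * g (n - k) =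
      ∑ m ∈ Finset.range M, c ^ m * D (m + 1) n * ((s ^ β) ^ m / Real.Gamma (β * m + 1)) := by
    simp only [Finset.sum_mul]
    rw [Finset.sum_comm]
    exact Finset.sum_congr rfl fun m _ => conv_seriesTerm hD n m s
  simp only [e]
  rw [fracIntegral_const_mul, fracIntegral_sum hβ ht _ fun m => ?_, Finset.sum_range_succ', add_comm,
    Finset.mul_sum]
  · congr 1
    · simp [seriesTerm, hD.1]
    · refine Finset.sum_congr rfl fun m _ => ?_
      rw [fracIntegral_const_mul, fracIntegral_pow hβ ht, seriesTerm, mul_pow]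
      ring
  · exact (((((Real.continuous_rpow_const hβ.le)).pow m).div_const _).const_mul _).continuousOn

/-- The solution of a lower triangular fractional system is given by its Mittag-Leffler series. -/
lemma hasSum_seriesTerm (hβ : β ∈ Ioc (0 : ℝ) 1) (hD : IsConvPower g D)
    (hc : ∀ n, ContinuousOn (p n) (Ici 0)) (hd : ∀ n, ContDiffOn ℝ 1 (p n) (Ioi 0))
    (hi : ∀ n, ∀ T : ℝ, IntegrableOn (deriv (p n)) (Ioc 0 T))
    (h0 : ∀ n, p n 0 = if n = 0 then 1 else 0)
    (he : ∀ n, ∀ t : ℝ, 0 < t →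
      caputoDeriv β (p n) t = c * ∑ k ∈ Finset.range (n + 1), p k t * g (n - k))
    (N : ℕ) {T : ℝ} (hT : 0 ≤ T) : HasSum (seriesTerm β c D N T) (p N T) := by
  have hβ0 := hβ.1
  have hvolt (n : ℕ) {t : ℝ} (ht : 0 < t) := eq_add_fracIntegral_of_caputoDeriv hβ (hc n) (hd n)
    (hi n) (he n) ht
  set G := ∑ k ∈ Finset.range (N + 1), |g k| with hGdef
  have hG0 : 0 ≤ G := Finset.sum_nonneg fun k _ => abs_nonneg _
  have hb (n : ℕ) : ∃ B, ∀ t ∈ Icc 0 T, |p n t| ≤ B :=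
    isCompact_Icc.exists_bound_of_continuousOn ((hc n).mono Icc_subset_Ici_self)
  choose b hb using hb
  set B := ∑ n ∈ Finset.range (N + 1), |b n| with hBdef
  have hB0 : 0 ≤ B := Finset.sum_nonneg fun k _ => abs_nonneg _
  have hpB (n : ℕ) (hn : n ≤ N) (t : ℝ) (ht : t ∈ Icc 0 T) : |p n t| ≤ B :=
    ((hb n t ht).trans (le_abs_self _)).trans
      (Finset.single_le_sum (f := fun n => |b n|) (fun k _ => abs_nonneg _)
        (Finset.mem_range.2 (Nat.lt_succ_of_le hn)))
  have hcont (M n : ℕ) :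
      ContinuousOn (fun s => ∑ m ∈ Finset.range M, seriesTerm β c D n s m) (Ici 0) :=
    continuousOn_finsetSum _ fun m _ => continuousOn_seriesTerm hβ0 n m
  -- Picard iteration: the error after `M` terms is the image of the previous error under the
  -- Volterra map. The induction covers all `n ≤ N` at once because the convolution involves every
  -- lower component. The bound is the general term of a convergent Mittag-Leffler series, so it
  -- tends to `0`.
  have key (M : ℕ) : ∀ n ≤ N, ∀ t ∈ Icc 0 T,
      |p n t - ∑ m ∈ Finset.range M, seriesTerm β c D n t m| ≤
        B * ((|c| * G) ^ M * ((t ^ β) ^ M / Real.Gamma (β * M + 1))) := by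
    induction M with
    | zero => intro n hn t ht; simpa using hpB n hn t ht
    | succ M ih =>
      intro n hn t ht
      rcases ht.1.eq_or_lt with rfl | ht0
      · have e : ∑ m ∈ Finset.range (M + 1), seriesTerm β c D n 0 m = p n 0 := by
          rw [Finset.sum_range_succ', h0]
          simp [seriesTerm, Real.zero_rpow hβ0.ne', hD.1]
        rw [e, sub_self, abs_zero]
        have := Real.Gamma_pos_of_pos (s := β * (M + 1 : ℕ) + 1) (by positivity)
        positivity
      · rw [hvolt n ht0, partialSum_succ hβ0 hD ht0, h0, add_sub_add_left_eq_sub]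
        rw [← fracIntegral_sub hβ0 ht0 ?_ ?_]
        rotate_left
        · exact (continuousOn_finsetSum _ fun k _ => (hc k).mul_const _).const_mul _
        · exact (continuousOn_finsetSum _ fun k _ => (hcont M k).mul_const _).const_mul _
        refine (abs_fracIntegral_le hβ0 ht0 (w := fun s => (|c| * (B * (|c| * G) ^ M * G)) *
          ((s ^ β) ^ M / Real.Gamma (β * M + 1))) ?_ fun s hs => ?_).trans (le_of_eq ?_)
        · exact (((((Real.continuous_rpow_const hβ0.le)).pow M).div_const _).const_mul
            _).continuousOn
        · have hs' : s ∈ Icc 0 T := ⟨hs.1.le, hs.2.trans ht.2⟩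
          have hV : 0 ≤ B * ((|c| * G) ^ M * ((s ^ β) ^ M / Real.Gamma (β * M + 1))) := by
            have := Real.Gamma_pos_of_pos (s := β * M + 1) (by positivity)
            have := hs.1
            positivity
          have h1 := abs_conv_le (g := g)
            (v := fun k => p k s - ∑ m ∈ Finset.range M, seriesTerm β c D k s m) hV hn
            fun k hk => ih k hk s hs'
          rw [← mul_sub, ← Finset.sum_sub_distrib, abs_mul]
          simp only [← sub_mul]
          refine (mul_le_mul_of_nonneg_left h1 (abs_nonneg c)).trans (le_of_eq ?_)
          rw [← hGdef]
          ring
        · rw [fracIntegral_const_mul, fracIntegral_pow hβ0 ht0]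
          ring
  have hz : 0 ≤ |c| * G * T ^ β := by positivity
  have hml := summable_pow_div_Gamma hβ0 hz
  have hsum : Summable (seriesTerm β c D N T) := by
    refine Summable.of_norm_bounded hml fun m => ?_
    have hΓ := Real.Gamma_pos_of_pos (s := β * m + 1) (by positivity)
    rw [seriesTerm, norm_mul, norm_div, norm_pow, norm_mul, Real.norm_of_nonneg hΓ.le,
      Real.norm_of_nonneg (Real.rpow_nonneg hT β), Real.norm_eq_abs, Real.norm_eq_abs]
    calc _ ≤ (|c| * T ^ β) ^ m / Real.Gamma (β * m + 1) * G ^ m := by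
          have := hD.abs_le N m N le_rfl
          gcongr
      _ = _ := by rw [mul_right_comm |c|, mul_pow _ G]; ring
  have hlim : Tendsto (fun M => ∑ m ∈ Finset.range M, seriesTerm β c D N T m) atTop
      (𝓝 (p N T)) := by
    rw [tendsto_iff_norm_sub_tendsto_zero]
    refine squeeze_zero (fun M => norm_nonneg _) (fun M => ?_)
      (by simpa using hml.tendsto_atTop_zero.const_mul B)
    rw [norm_sub_rev]
    refine (key M N le_rfl T ⟨hT, le_rfl⟩).trans (le_of_eq ?_)
    rw [mul_pow _ (T ^ β)]
    ring
  have := hsum.hasSum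
  rwa [tendsto_nhds_unique this.tendsto_sum_nat hlim] at this

end

section

variable {α β lam₀ ξ t : ℝ}

/-! ### The Prabhakar kernels -/

lemma eventually_mul_rpow_le (hα : 0 < α) (hlam : 0 < lam₀) :
    ∀ᶠ h in 𝓝[>] (0 : ℝ), 0 < h ∧ 0 ≤ lam₀ * h ^ α ∧ lam₀ * h ^ α ≤ 1 / 8 := by
  have h1 : Tendsto (fun h : ℝ => lam₀ * h ^ α) (𝓝[>] 0) (𝓝 0) := by
    simpa using (tendsto_rpow_zero hα).const_mul lam₀
  filter_upwards [self_mem_nhdsWithin, h1.eventually_lt_const (show (0 : ℝ) < 1 / 8 by norm_num)]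
    with h (hh : 0 < h) h8
  exact ⟨hh, by positivity, h8.le⟩

lemma isLatticeApprox_discretePrabhakar (hα : α ∈ Ioc (0 : ℝ) 1) (hlam : 0 < lam₀) (m : ℕ) :
    IsLatticeApprox α lam₀ (2 ^ m) (fun _ => risingCoeff m) (risingCoeff m)
      fun h => discretePrabhakar α m (lam₀ * h ^ α) where
  nonneg := by positivity
  tendsto _ := tendsto_const_nhds
  bound := Eventually.of_forall fun _ => abs_risingCoeff_natCast_le m
  hasSum := by
    filter_upwards [eventually_mul_rpow_le hα.1 hlam] with h hh n
    exact hasSum_discretePrabhakar hα hh.2.1 hh.2.2 m n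

lemma prabhakarKernel_apply (α γ ζ : ℝ) (φ : 𝓓((⊤ : Opens ℝ), ℝ)) :
    prabhakarKernel α γ ζ φ =
      risingCoeff γ 0 * φ 0 + regularDist (kernelDensity α (risingCoeff γ) ζ) φ := by
  rw [risingCoeff_zero_right, one_mul]
  rfl

lemma prabhakarKernel_eq_lineDeriv (hα : α ∈ Ioc (0 : ℝ) 1) (hlam : 0 < lam₀) (m : ℕ) :
    prabhakarKernel α m (-lam₀) = ∂_{(1 : ℝ)} (regularDist fun x =>
      heaviside x * prabhakar α 1 m (-lam₀ * x ^ α)) := by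
  ext φ
  rw [prabhakarKernel_apply]
  exact (lineDeriv_regularDist_kernelPrimitive hα hlam (C := 2 ^ m) (by positivity)
    (abs_risingCoeff_natCast_le m) φ).symm

/-! ### The state probabilities -/

/-- The weight of `𝓔^(m)` in the state probabilities at time `t`. -/
noncomputable def stateWeight (β c t : ℝ) (m : ℕ) : ℝ := (c * t ^ β) ^ m / Real.Gamma (β * m + 1)

lemma abs_stateWeight_le (hβ : 0 < β) (ht : 0 ≤ t) {c C : ℝ} (hc : |c| ≤ C) (m : ℕ) :
    |stateWeight β c t m| * 2 ^ m ≤ (2 * C * t ^ β) ^ m / Real.Gamma (β * m + 1) := by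
  have hΓ := Real.Gamma_pos_of_pos (s := β * m + 1) (by positivity)
  rw [stateWeight, abs_div, abs_pow, abs_mul, abs_of_pos hΓ, abs_of_nonneg (Real.rpow_nonneg ht β),
    div_mul_eq_mul_div, ← mul_pow]
  rw [show |c| * t ^ β * 2 = 2 * |c| * t ^ β by ring]
  gcongr

lemma summable_stateWeight (hβ : 0 < β) (ht : 0 ≤ t) (c : ℝ) :
    Summable fun m => |stateWeight β c t m| * 2 ^ m :=
  Summable.of_nonneg_of_le (fun m => by positivity) (abs_stateWeight_le hβ ht le_rfl)
    (summable_pow_div_Gamma hβ (by positivity))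

lemma hasSum_stateProb (hα : α ∈ Ioc (0 : ℝ) 1) (hβ : β ∈ Ioc (0 : ℝ) 1) {lam : ℝ} (h0 : 0 ≤ lam)
    (h1 : lam ≤ 1 / 8) {p : ℕ → ℝ → ℝ} (hp : IsStateProb α β lam ξ p) (ht : 0 ≤ t) (n : ℕ) :
    HasSum (fun m => stateWeight β (-ξ * (lam + 1)) t m * discretePrabhakar α m lam n) (p n t) :=
  hasSum_seriesTerm (D := fun m n => discretePrabhakar α m lam n) hβ
    ⟨discretePrabhakar_zero α lam, discretePrabhakar_succ hα h0 h1⟩ hp.continuousOn hp.contDiffOn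
    hp.integrable_deriv hp.init hp.evol n ht

/-- The series over `m` of `hasSum_stateProb`, with each `𝓔^(m)` expanded over `s` and the sums
exchanged. -/
lemma hasSum_stateProb_weights (hα : α ∈ Ioc (0 : ℝ) 1) (hβ : β ∈ Ioc (0 : ℝ) 1) {lam : ℝ}
    (h0 : 0 ≤ lam) (h1 : lam ≤ 1 / 8) {p : ℕ → ℝ → ℝ} (hp : IsStateProb α β lam ξ p) (ht : 0 ≤ t)
    (n : ℕ) : HasSum (fun s : ℕ => superposedWeight (stateWeight β (-ξ * (lam + 1)) t) s *
      ((-lam) ^ s * risingCoeff (α * s) n)) (p n t) := by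
  have h := hasSum_superposition_right
    (abs_mul_risingCoeff_le (stateWeight β (-ξ * (lam + 1)) t))
    (summable_stateWeight hβ.1 ht (-ξ * (lam + 1))) (summable_two_pow_mul_weight hα h0 h1 n)
  have e (m : ℕ) : ∑' s : ℕ, stateWeight β (-ξ * (lam + 1)) t m * risingCoeff m s *
      ((-lam) ^ s * risingCoeff (α * s) n) =
      stateWeight β (-ξ * (lam + 1)) t m * discretePrabhakar α m lam n := by
    simp only [mul_assoc]
    rw [tsum_mul_left, discretePrabhakar_eq hα h0 h1]
  simp only [e] at h
  rwa [(hasSum_stateProb hα hβ h0 h1 hp ht n).tsum_eq] at h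

/-- In the constant, `|ξ| * 2` bounds `|-ξ (lam₀ h ^ α + 1)|` for small `h`, and the other factor
`2` comes from `(m)ₛ / s! ≤ 2 ^ m 2 ^ s`. The weights converge because `-ξ (lam₀ h ^ α + 1) → -ξ`.
-/
lemma isLatticeApprox_stateProb (hα : α ∈ Ioc (0 : ℝ) 1) (hβ : β ∈ Ioc (0 : ℝ) 1)
    (hlam : 0 < lam₀) {p : ℝ → ℕ → ℝ → ℝ}
    (hp : ∀ h : ℝ, 0 < h → IsStateProb α β (lam₀ * h ^ α) ξ (p h)) (ht : 0 ≤ t) :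
    IsLatticeApprox α lam₀ (∑' m : ℕ, (2 * (|ξ| * 2) * t ^ β) ^ m / Real.Gamma (β * m + 1))
      (fun h => superposedWeight (stateWeight β (-ξ * (lam₀ * h ^ α + 1)) t))
      (superposedWeight (mlCoeff β ξ t)) fun h n => p h n t := by
  have hsum : Summable fun m : ℕ => (2 * (|ξ| * 2) * t ^ β) ^ m / Real.Gamma (β * m + 1) :=
    summable_pow_div_Gamma hβ.1 (by positivity)
  have hc : ∀ᶠ h in 𝓝[>] (0 : ℝ), |-ξ * (lam₀ * h ^ α + 1)| ≤ |ξ| * 2 := by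
    filter_upwards [eventually_mul_rpow_le hα.1 hlam] with h hh
    rw [abs_mul, abs_neg]
    refine mul_le_mul_of_nonneg_left ?_ (abs_nonneg _)
    rw [abs_of_nonneg (by linarith [hh.2.1])]
    linarith [hh.2.2]
  refine ⟨tsum_nonneg fun m => ?_, fun s => ?_, ?_, ?_⟩
  · have hβ0 := hβ.1
    have := Real.Gamma_pos_of_pos (s := β * m + 1) (by positivity)
    positivity
  · refine tendsto_tsum_of_dominated_convergence (hsum.mul_right (2 ^ s)) (fun m => ?_) ?_
    · refine Tendsto.mul_const _ ?_
      have h1 : Tendsto (fun h : ℝ => -ξ * (lam₀ * h ^ α + 1)) (𝓝[>] 0) (𝓝 (-ξ)) := by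
        simpa using (((tendsto_rpow_zero hα.1).const_mul lam₀).add_const 1).const_mul (-ξ)
      exact ((h1.mul_const (t ^ β)).pow m).div_const _
    · filter_upwards [hc] with h hh m
      exact (abs_mul_risingCoeff_le _ m s).trans
        (mul_le_mul_of_nonneg_right (abs_stateWeight_le hβ.1 ht hh m) (by positivity))
  · filter_upwards [hc] with h hh s
    refine (abs_superposedWeight_le (summable_stateWeight hβ.1 ht _) s).trans ?_
    exact mul_le_mul_of_nonneg_right ((summable_stateWeight hβ.1 ht _).tsum_le_tsum
      (abs_stateWeight_le hβ.1 ht hh) hsum) (by positivity)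
  · filter_upwards [eventually_mul_rpow_le hα.1 hlam] with h hh n
    exact hasSum_stateProb_weights hα hβ hh.2.1 hh.2.2 (hp h hh.1) ht n

end

end SpaceTimeML

/-! ### The continuous-space limit. -/

theorem mainTheorem2 (α β lam₀ ξ : ℝ) (hα : α ∈ Ioc (0 : ℝ) 1) (hβ : β ∈ Ioc (0 : ℝ) 1)
    (hlam₀ : 0 < lam₀) (hξ : 0 < ξ) :
    -- the Prabhakar kernels `e^m_{α,0}(-lam₀, ·)`
    (∀ m : ℕ,
      -- limits of the discrete coefficients, as distributions on `ℝ` and at each point `x > 0`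
      (∀ φ : 𝓓((⊤ : Opens ℝ), ℝ),
        Tendsto (fun h : ℝ =>
            SpaceTimeML.regularDist (SpaceTimeML.latticeDensity h
              (SpaceTimeML.discretePrabhakar α m (lam₀ * h ^ α))) φ)
          (𝓝[>] 0) (𝓝 (SpaceTimeML.prabhakarKernel α m (-lam₀) φ))) ∧
      (∀ x : ℝ, 0 < x →
        Tendsto (fun h : ℝ => (1 / h) *
            SpaceTimeML.discretePrabhakar α m (lam₀ * h ^ α) ⌊x / h⌋₊)
          (𝓝[>] 0) (𝓝 (SpaceTimeML.prabhakarDensity α m (-lam₀) x))) ∧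
      -- `e^m_{α,0}(-lam₀, x) = D_x [Θ(x) E^m_{α,1}(-lam₀ x ^ α)]`
      SpaceTimeML.prabhakarKernel α m (-lam₀) =
        ∂_{(1 : ℝ)} (SpaceTimeML.regularDist fun x =>
          SpaceTimeML.heaviside x * SpaceTimeML.prabhakar α 1 m (-lam₀ * x ^ α)) ∧
      -- the Laplace transform is `(1 + lam₀ s ^ (-α)) ^ (-m)`
      (∀ s : ℂ, 0 < s.re → lam₀ < s.re ^ α →
        IntegrableOn (fun x : ℝ => Complex.exp (-s * x) *
          (SpaceTimeML.prabhakarDensity α m (-lam₀) x : ℂ)) (Ioi 0) ∧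
        1 + ∫ x in Ioi (0 : ℝ), Complex.exp (-s * x) *
            (SpaceTimeML.prabhakarDensity α m (-lam₀) x : ℂ) =
          ((1 + (lam₀ : ℂ) * s ^ (-(α : ℂ))) ^ m)⁻¹)) ∧
    -- the state density
    (∀ p : ℝ → ℕ → ℝ → ℝ,
      (∀ h : ℝ, 0 < h → SpaceTimeML.IsStateProb α β (lam₀ * h ^ α) ξ (p h)) →
      ∀ t : ℝ, 0 ≤ t →
        ∃ P : 𝓓'((⊤ : Opens ℝ), ℝ),
          -- `P` is the limit of the rescaled state probabilities
          (∀ φ : 𝓓((⊤ : Opens ℝ), ℝ),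
            Tendsto (fun h : ℝ =>
                SpaceTimeML.regularDist (SpaceTimeML.latticeDensity h fun n => p h n t) φ)
              (𝓝[>] 0) (𝓝 (P φ))) ∧
          -- `P = ∑ₘ (-ξ t ^ β) ^ m / Γ(β m + 1) e^m_{α,0}(-lam₀, ·)`
          (∀ φ : 𝓓((⊤ : Opens ℝ), ℝ),
            HasSum (fun m : ℕ => SpaceTimeML.mlCoeff β ξ t m *
              SpaceTimeML.prabhakarKernel α m (-lam₀) φ) (P φ)) ∧
          -- the same at each point `x > 0`
          (∀ x : ℝ, 0 < x →
            Summable (fun m : ℕ => SpaceTimeML.mlCoeff β ξ t m *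
              SpaceTimeML.prabhakarDensity α m (-lam₀) x) ∧
            Tendsto (fun h : ℝ => (1 / h) * p h ⌊x / h⌋₊ t) (𝓝[>] 0)
              (𝓝 (∑' m : ℕ, SpaceTimeML.mlCoeff β ξ t m *
                SpaceTimeML.prabhakarDensity α m (-lam₀) x))) ∧
          -- `P = D_x [Θ(x) ∑ₘ (-ξ t ^ β) ^ m / Γ(β m + 1) E^m_{α,1}(-lam₀ x ^ α)]`
          (∀ x : ℝ, 0 ≤ x →
            Summable (fun m : ℕ => SpaceTimeML.mlCoeff β ξ t m *
              SpaceTimeML.prabhakar α 1 m (-lam₀ * x ^ α))) ∧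
          P = ∂_{(1 : ℝ)} (SpaceTimeML.regularDist fun x =>
            SpaceTimeML.heaviside x * ∑' m : ℕ, SpaceTimeML.mlCoeff β ξ t m *
              SpaceTimeML.prabhakar α 1 m (-lam₀ * x ^ α))) := by
  refine ⟨fun m => ⟨fun φ => ?_, fun x hx => ?_, ?_, fun s hs hs' => ?_⟩, fun p hp t ht => ?_⟩
  · rw [SpaceTimeML.prabhakarKernel_apply]
    exact (SpaceTimeML.isLatticeApprox_discretePrabhakar hα hlam₀ m).tendsto_distribution hα hlam₀ φ
  · exact (SpaceTimeML.isLatticeApprox_discretePrabhakar hα hlam₀ m).tendsto_pointwise hα hlam₀ hx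
  · exact SpaceTimeML.prabhakarKernel_eq_lineDeriv hα hlam₀ m
  · exact SpaceTimeML.laplace_prabhakarDensity hα hlam₀ m hs hs'
  · have H := SpaceTimeML.isLatticeApprox_stateProb hα hβ hlam₀ hp ht
    have ha : Summable fun m => |SpaceTimeML.mlCoeff β ξ t m| * 2 ^ m :=
      SpaceTimeML.summable_stateWeight hβ.1 ht (-ξ)
    have hprim (x : ℝ) (hx : 0 ≤ x) :=
      SpaceTimeML.hasSum_kernelPrimitive_superposed hα hlam₀ ha hx
    have hfun : (fun x => SpaceTimeML.heaviside x * ∑' m : ℕ, SpaceTimeML.mlCoeff β ξ t m *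
        SpaceTimeML.prabhakar α 1 m (-lam₀ * x ^ α)) = fun x => SpaceTimeML.heaviside x *
          SpaceTimeML.kernelPrimitive α
            (SpaceTimeML.superposedWeight (SpaceTimeML.mlCoeff β ξ t)) (-lam₀) x := by
      ext x
      by_cases hx : 0 ≤ x
      · rw [← (hprim x hx).tsum_eq]
        rfl
      · simp [SpaceTimeML.heaviside, hx]
    -- The closing `rfl` fixes the witness as the distributional derivative; the delta-plus-density
    -- form is recovered through `lineDeriv_regularDist_kernelPrimitive`.
    refine ⟨_, fun φ => ?_, fun φ => ?_, fun x hx => ⟨?_, ?_⟩, fun x hx => (hprim x hx).summable, rfl⟩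
    · rw [hfun, SpaceTimeML.lineDeriv_regularDist_kernelPrimitive hα hlam₀ H.nonneg H.bound_limit]
      exact H.tendsto_distribution hα hlam₀ φ
    · rw [hfun, SpaceTimeML.lineDeriv_regularDist_kernelPrimitive hα hlam₀ H.nonneg H.bound_limit]
      have h1 : Summable (SpaceTimeML.mlCoeff β ξ t) :=
        Summable.of_norm_bounded ha fun m => le_mul_of_one_le_right (abs_nonneg _)
          (one_le_pow₀ (by norm_num))
      have h2 := (h1.hasSum.mul_right (φ 0)).add
        (SpaceTimeML.hasSum_regularDist_superposed hα hlam₀ ha φ)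
      rw [SpaceTimeML.superposedWeight_zero]
      simpa only [SpaceTimeML.prabhakarKernel_apply, SpaceTimeML.risingCoeff_zero_right, one_mul,
        mul_add] using h2
    · exact (SpaceTimeML.hasSum_kernelDensity_superposed hα hlam₀ ha x).summable
    · have h := (SpaceTimeML.hasSum_kernelDensity_superposed hα hlam₀ ha x).tsum_eq
      simp only [SpaceTimeML.prabhakarDensity_eq]
      rw [h]
      exact H.tendsto_pointwise hα hlam₀ hx
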